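/- Let $\Lambda$ be a set of spectral parameters (for instance a set of complex numbers) and let $a_-,b_\pm,c_\pm:\Lambda\times\Lambda\to\mathbb C$ be arbitrary weights such that the $R$-matrix $$R_{12}(u,v)=\begin{pmatrix}1&0&0&0\\0&b_+(u,v)&c_+(u,v)&0\\0&c_-(u,v)&b_-(u,v)&0\\0&0&0&a_-(u,v)\end{pmatrix}$$ on $\mathbb C^2\otimes\mathbb C^2$ satisfies unitarity $R_{12}(u,v)R_{21}(v,u)=1$ and the Yang-Baxter equation $R_{12}(u,v)R_{13}(u,w)R_{23}(v,w)=R_{23}(v,w)R_{13}(u,w)R_{12}(u,v)$ for all $u,v,w\in\Lambda$. For $\xi=(\xi_1,\dots,\xi_L)\in\Lambda^L$ write the monodromy matrix as a $2\times2$ matrix in the auxiliary space $a$, $$R_{aL}(u,\xi_L)\cdots R_{a1}(u,\xi_1)=\begin{pmatrix}A(u)&B(u)\\C(u)&D(u)\end{pmatrix}_a ,$$ with entries acting on $(\mathbb C^2)^{\otimes L}$, and let $|1\rangle=\bigotimes_i\binom01_i$, $|0\rangle=\bigotimes_i\binom10_i$, with transposes $\langle1|$, $\langle0|$. Assume $b_-(\xi_i,\xi_j)\neq0$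 for all $i\ne j$. Let $L,M\ge0$ be integers and let $\mu_1,\dots,\mu_M,\nu_1,\dots,\nu_M\in\Lambda$ be arbitrary (free). For $\eta\in\Lambda^M$ let $Z^{(B)}_M(\{\mu\},\eta)=\langle1|B(\mu_1)\cdots B(\mu_M)|0\rangle$ and $Z^{(C)}_M(\{\nu\},\eta)=\langle0|C(\nu_M)\cdots C(\nu_1)|1\rangle$, where $B$, $C$ are now the operators on $M$ sites with inhomogeneities $\eta_1,\dots,\eta_M$. Put $\theta(\xi_i,\xi_j)=a_-(\xi_i,\xi_j)$ if $i<j$ and $\theta(\xi_i,\xi_j)=1$ if $i\ge j$, and, for $1\le l_1<\dots<l_M\le L$, $$w_l=\prod_{m=1}^M\ \prod_{\substack{1\le p\le L\\ p\ne l_1,\dots,l_M}}\frac{a_-(\mu_m,\xi_p)\,a_-(\nu_m,\xi_p)}{b_-(\xi_p,\xi_{l_m})\,a_-(\xi_{l_m},\xi_p)} .$$ Then the scalar product $\mathcal S(\{\mu\},\{\nu\})=\langle1|B(\mu_1)\cdots B(\mu_M)C(\nu_M)\cdots C(\nu_1)|1\rangle$ on $L$ sites satisfies $$\mathcal S(\{\mu\},\{\nu\})=\sum_{1\le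 l_1<\dots<l_M\le L}w_l\;Z^{(C)}_M(\{\nu\},(\xi_{l_1},\dots,\xi_{l_M}))\;Z^{(B)}_M(\{\mu\},(\xi_{l_1},\dots,\xi_{l_M}))$$ and $$\mathcal S(\{\mu\},\{\nu\})=\sum_{1\le l_1<\dots<l_M\le L}\ \sum_{\sigma,\tau\in S_M}w_l\prod_{i=1}^Mc_-(\nu_i,\xi_{l_{\sigma_i}})\,c_+(\mu_i,\xi_{l_{\tau_i}})\prod_{1\le j<k\le M}\frac{\theta(\xi_{l_{\sigma_k}},\xi_{l_{\sigma_j}})}{\theta(\xi_{l_{\tau_j}},\xi_{l_{\tau_k}})}\cdot\frac{b_-(\nu_k,\xi_{l_{\sigma_j}})\,b_-(\mu_k,\xi_{l_{\tau_j}})\,a_-(\nu_j,\xi_{l_{\sigma_k}})\,a_-(\mu_j,\xi_{l_{\tau_k}})}{b_-(\xi_{l_{\sigma_k}},\xi_{l_{\sigma_j}})\,b_-(\xi_{l_{\tau_k}},\xi_{l_{\tau_j}})} .$$ -/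

import Mathlib

/-- The Boltzmann weights `a₋, b₊, b₋, c₊, c₋` of a fully asymmetric six-vertex model whose weight
`a₊` is normalized to `1`, as arbitrary complex functions of two spectral parameters, which range
over a set `Λ`. -/
structure SixVertexWeights (Λ : Type*) where
  aMinus : Λ → Λ → ℂ
  bPlus : Λ → Λ → ℂ
  bMinus : Λ → Λ → ℂ
  cPlus : Λ → Λ → ℂ
  cMinus : Λ → Λ → ℂ

namespace SixVertexWeights

/-- The `R`-matrix on `ℂ² ⊗ ℂ²`. The two basis vectors `(1,0)ᵗ`, `(0,1)ᵗ` of `ℂ²` are indexed by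
`0, 1 : Fin 2`, and the four of `ℂ² ⊗ ℂ²` are listed in the order `(0,0), (0,1), (1,0), (1,1)`. -/
noncomputable def R {Λ : Type*} (W : SixVertexWeights Λ) (u v : Λ) :
    Matrix (Fin 2 × Fin 2) (Fin 2 × Fin 2) ℂ :=
  Matrix.submatrix
    !![1, 0, 0, 0;
       0, W.bPlus u v, W.cPlus u v, 0;
       0, W.cMinus u v, W.bMinus u v, 0;
       0, 0, 0, W.aMinus u v]
    finProdFinEquiv finProdFinEquiv

end SixVertexWeights

/-- The operator `X_{ij}` on `⊗_{k : ι} ℂ²` that acts as `X` on the ordered pair of distinct tensor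
factors `i, j` and as the identity on all the others. Basis vectors of `⊗_{k : ι} ℂ²` are indexed by
functions `ι → Fin 2`. -/
def actOnPair {ι : Type*} [Fintype ι] [DecidableEq ι] (X : Matrix (Fin 2 × Fin 2) (Fin 2 × Fin 2) ℂ)
    (i j : ι) : Matrix (ι → Fin 2) (ι → Fin 2) ℂ :=
  fun s t => if ∀ k, k ≠ i → k ≠ j → s k = t k then X (s i, s j) (t i, t j) else 0

namespace SixVertexWeights

/-- Unitarity: `R₁₂(u,v) R₂₁(v,u) = 1`. -/
def IsUnitary {Λ : Type*} (W : SixVertexWeights Λ) : Prop :=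
  ∀ u v : Λ, actOnPair (W.R u v) (0 : Fin 2) 1 * actOnPair (W.R v u) (1 : Fin 2) 0 = 1

/-- The Yang-Baxter equation `R₁₂(u,v) R₁₃(u,w) R₂₃(v,w) = R₂₃(v,w) R₁₃(u,w) R₁₂(u,v)`. -/
def YangBaxter {Λ : Type*} (W : SixVertexWeights Λ) : Prop :=
  ∀ u v w : Λ,
    actOnPair (W.R u v) (0 : Fin 3) 1 * actOnPair (W.R u w) (0 : Fin 3) 2 *
        actOnPair (W.R v w) (1 : Fin 3) 2 =
      actOnPair (W.R v w) (1 : Fin 3) 2 * actOnPair (W.R u w) (0 : Fin 3) 2 *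
        actOnPair (W.R u v) (0 : Fin 3) 1

/-- The monodromy matrix `R_{aL}(u,ξ_L) ⋯ R_{a1}(u,ξ_1)`. The auxiliary space `a` is the tensor
factor `0 : Fin (L + 1)`, the quantum space `V_i` is the factor `i.succ`. -/
noncomputable def monodromy {Λ : Type*} (W : SixVertexWeights Λ) {L : ℕ} (ξ : Fin L → Λ) (u : Λ) :
    Matrix (Fin (L + 1) → Fin 2) (Fin (L + 1) → Fin 2) ℂ :=
  (List.ofFn fun i : Fin L => actOnPair (W.R u (ξ i)) (0 : Fin (L + 1)) i.succ).reverse.prod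

/-- The upper right entry `B(u)` of the monodromy matrix, written as a `2 × 2` matrix in the
auxiliary space. -/
noncomputable def opB {Λ : Type*} (W : SixVertexWeights Λ) {L : ℕ} (ξ : Fin L → Λ) (u : Λ) :
    Matrix (Fin L → Fin 2) (Fin L → Fin 2) ℂ :=
  fun s t => W.monodromy ξ u (Fin.cons 0 s) (Fin.cons 1 t)

/-- The lower left entry `C(u)` of the monodromy matrix, written as a `2 × 2` matrix in the
auxiliary space. -/
noncomputable def opC {Λ : Type*} (W : SixVertexWeights Λ) {L : ℕ} (ξ : Fin L → Λ) (u : Λ) :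
    Matrix (Fin L → Fin 2) (Fin L → Fin 2) ℂ :=
  fun s t => W.monodromy ξ u (Fin.cons 1 s) (Fin.cons 0 t)

end SixVertexWeights

/-- The reference state `|0⟩ = ⊗_i (1,0)ᵗ`, and also its transpose `⟨0|`. -/
def state0 (L : ℕ) : (Fin L → Fin 2) → ℂ := fun s => ∏ i, (![1, 0] : Fin 2 → ℂ) (s i)

/-- The reference state `|1⟩ = ⊗_i (0,1)ᵗ`, and also its transpose `⟨1|`. -/
def state1 (L : ℕ) : (Fin L → Fin 2) → ℂ := fun s => ∏ i, (![0, 1] : Fin 2 → ℂ) (s i)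

namespace SixVertexWeights

/-- The product `B(μ₁) B(μ₂) ⋯ B(μ_M)`. -/
noncomputable def prodB {Λ : Type*} (W : SixVertexWeights Λ) {L M : ℕ} (ξ : Fin L → Λ)
    (μ : Fin M → Λ) : Matrix (Fin L → Fin 2) (Fin L → Fin 2) ℂ :=
  (List.ofFn fun m => W.opB ξ (μ m)).prod

/-- The product `C(ν_M) ⋯ C(ν₂) C(ν₁)`. -/
noncomputable def prodC {Λ : Type*} (W : SixVertexWeights Λ) {L M : ℕ} (ξ : Fin L → Λ)
    (ν : Fin M → Λ) : Matrix (Fin L → Fin 2) (Fin L → Fin 2) ℂ :=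
  (List.ofFn fun m => W.opC ξ (ν m)).reverse.prod

open Matrix in
/-- The scalar product `⟨1| B(μ₁) ⋯ B(μ_M) C(ν_M) ⋯ C(ν₁) |1⟩`. -/
noncomputable def scalarProduct {Λ : Type*} (W : SixVertexWeights Λ) {L M : ℕ} (ξ : Fin L → Λ)
    (μ ν : Fin M → Λ) : ℂ :=
  state1 L ⬝ᵥ ((W.prodB ξ μ * W.prodC ξ ν) *ᵥ state1 L)

open Matrix in
/-- The domain wall partition function of type `B`: `⟨1| B(μ₁) ⋯ B(μ_M) |0⟩` on `M` sites with
inhomogeneities `η`. -/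
noncomputable def dwpfB {Λ : Type*} (W : SixVertexWeights Λ) {M : ℕ} (μ η : Fin M → Λ) : ℂ :=
  state1 M ⬝ᵥ (W.prodB η μ *ᵥ state0 M)

open Matrix in
/-- The domain wall partition function of type `C`: `⟨0| C(ν_M) ⋯ C(ν₁) |1⟩` on `M` sites with
inhomogeneities `η`. -/
noncomputable def dwpfC {Λ : Type*} (W : SixVertexWeights Λ) {M : ℕ} (ν η : Fin M → Λ) : ℂ :=
  state0 M ⬝ᵥ (W.prodC η ν *ᵥ state1 M)

/-- `θ(ξ_i, ξ_j)`, which is `a₋(ξ_i, ξ_j)` if `i < j` and `1` if `i ≥ j`. -/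
noncomputable def theta {Λ : Type*} (W : SixVertexWeights Λ) {L : ℕ} (ξ : Fin L → Λ)
    (i j : Fin L) : ℂ :=
  if i < j then W.aMinus (ξ i) (ξ j) else 1

/-- The coefficient
`∏_{m} ∏_{p ≠ l₁,…,l_M} a₋(μ_m,ξ_p) a₋(ν_m,ξ_p) / (b₋(ξ_p,ξ_{l_m}) a₋(ξ_{l_m},ξ_p))`. -/
noncomputable def subsetWeight {Λ : Type*} (W : SixVertexWeights Λ) {L M : ℕ} (ξ : Fin L → Λ)
    (μ ν : Fin M → Λ) (l : Fin M → Fin L) : ℂ :=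
  ∏ m : Fin M, ∏ p ∈ (Finset.univ.image l)ᶜ,
    (W.aMinus (μ m) (ξ p) * W.aMinus (ν m) (ξ p)) /
      (W.bMinus (ξ p) (ξ (l m)) * W.aMinus (ξ (l m)) (ξ p))

end SixVertexWeights

/-! The proof works with monodromy matrices `mono` over an arbitrary ordering of the sites. By
Yang-Baxter, exchanging two neighbouring sites conjugates every entry by an R-matrix
(`YangBaxter.mono_swap`), so a site `l` can be carried to the end of the ordering by a product `Xop`
of R-matrices.

The key expansion is `YangBaxter.mono_one_zero_ket`: C(u) applied to an all-ones state on `S` is a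
sum over `l ∈ S`, with explicit coefficients, of `Xop` applied to the state with a single 0 at `l`.
Pulling a further C through `Xop` puts `l` last, and there the 0 contributes only a factor b₋ while
C acts on `S \ {l}`. Iterating gives a sum over injective choices of sites
(`YangBaxter.dotProduct_creations`). The operators `Xop` that pile up on the left are absorbed by
pairing with a family of row vectors, one per ordering, that R-matrices permute (`IsCovariant`).

Two such families suffice. The constant family ⟨0| yields the permutation sum for the partition
function of type C, and transposition carries it over to type B. The family ⟨1|B(μ₁)⋯B(μ_M),
normalized by the factors a₋ of the inversions of the ordering, yields the scalar product: the
untouched sites contribute a₋, and the chosen ones a partition function of type B that depends only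
on the chosen subset. The sum over orders of choice of a fixed subset is then the partition function
of type C. -/

open Matrix Function

/-! ### Operators on one or two tensor factors. -/

section SiteOperators

variable {ι : Type*} [Fintype ι] [DecidableEq ι]

/-- The operator on `⊗_{k : ι} ℂ²` acting as `A` on the factor `i`. -/
def siteOp (i : ι) (A : Matrix (Fin 2) (Fin 2) ℂ) : Matrix (ι → Fin 2) (ι → Fin 2) ℂ :=
  fun s t => if ∀ k, k ≠ i → s k = t k then A (s i) (t i) else 0

theorem siteOp_mulVec (i : ι) (A : Matrix (Fin 2) (Fin 2) ℂ) (v : (ι → Fin 2) → ℂ) :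
    siteOp i A *ᵥ v = fun s => ∑ a, A (s i) a * v (update s i a) := by
  funext s
  symm
  refine Fintype.sum_of_injective (fun a => update s i a) (update_injective s i) _ _ ?_ ?_
  · intro r hr
    simp only [siteOp]
    rw [if_neg, zero_mul]
    intro h
    refine hr ⟨r i, funext fun k => ?_⟩
    rcases eq_or_ne k i with rfl | hk
    · simp
    · simp [hk, h k hk]
  · intro a
    simp only [siteOp, update_self]
    rw [if_pos]
    intro k hk
    simp [hk]

theorem actOnPair_mulVec {i j : ι} (hij : i ≠ j) (X : Matrix (Fin 2 × Fin 2) (Fin 2 × Fin 2) ℂ)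
    (v : (ι → Fin 2) → ℂ) :
    actOnPair X i j *ᵥ v =
      fun s => ∑ a, ∑ b, X (s i, s j) (a, b) * v (update (update s i a) j b) := by
  funext s
  rw [← Fintype.sum_prod_type' (f := fun a b => X (s i, s j) (a, b) * v (update (update s i a) j b))]
  symm
  refine Fintype.sum_of_injective
    (fun x : Fin 2 × Fin 2 => update (update s i x.1) j x.2) ?_ _ _ ?_ ?_
  · rintro ⟨a, b⟩ ⟨c, d⟩ h
    have h1 := congrFun h i
    have h2 := congrFun h j
    simp [hij] at h1 h2
    simp [h1, h2]
  · intro r hr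
    simp only [actOnPair]
    rw [if_neg, zero_mul]
    intro h
    refine hr ⟨(r i, r j), funext fun k => ?_⟩
    rcases eq_or_ne k j with rfl | hk
    · simp
    rcases eq_or_ne k i with rfl | hk'
    · simp [hk]
    · simp [hk, hk', h k hk' hk]
  · rintro ⟨a, b⟩
    simp only [actOnPair, update_self, update_of_ne hij]
    rw [if_pos]
    intro k hk hk'
    simp [hk, hk']

theorem matrix_ext_mulVec {m n : Type*} [Fintype n] [DecidableEq n] {X Y : Matrix m n ℂ}
    (h : ∀ v, X *ᵥ v = Y *ᵥ v) : X = Y := by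
  ext a b
  simpa using congrFun (h (Pi.single b 1)) a

theorem siteOp_mul_self (i : ι) (A B : Matrix (Fin 2) (Fin 2) ℂ) :
    siteOp i A * siteOp i B = siteOp i (A * B) := by
  refine matrix_ext_mulVec fun v => ?_
  rw [← mulVec_mulVec]
  funext s
  simp only [siteOp_mulVec, Matrix.mul_apply, Fin.sum_univ_two, update_self, update_idem]
  ring

theorem siteOp_smul (i : ι) (z : ℂ) (A : Matrix (Fin 2) (Fin 2) ℂ) :
    siteOp i (z • A) = z • siteOp i A := by
  ext s t; simp [siteOp]

theorem siteOp_zero (i : ι) : siteOp i 0 = 0 := by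
  ext s t; simp [siteOp]

theorem siteOp_transpose (i : ι) (A : Matrix (Fin 2) (Fin 2) ℂ) :
    (siteOp i A)ᵀ = siteOp i Aᵀ := by
  ext s t; simp [siteOp, eq_comm]

theorem siteOp_commute {i j : ι} (hij : i ≠ j) (A B : Matrix (Fin 2) (Fin 2) ℂ) :
    Commute (siteOp i A) (siteOp j B) := by
  refine matrix_ext_mulVec fun v => ?_
  rw [← mulVec_mulVec, ← mulVec_mulVec]
  funext s
  simp only [siteOp_mulVec, Fin.sum_univ_two, update_of_ne hij, update_of_ne hij.symm,
    update_comm hij]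
  ring

theorem actOnPair_commute_siteOp {i j k : ι} (hij : i ≠ j) (hik : i ≠ k) (hjk : j ≠ k)
    (X : Matrix (Fin 2 × Fin 2) (Fin 2 × Fin 2) ℂ) (A : Matrix (Fin 2) (Fin 2) ℂ) :
    Commute (actOnPair X i j) (siteOp k A) := by
  refine matrix_ext_mulVec fun v => ?_
  rw [← mulVec_mulVec, ← mulVec_mulVec]
  funext s
  simp only [siteOp_mulVec, actOnPair_mulVec hij, Fin.sum_univ_two, update_of_ne hik,
    update_of_ne hjk, update_of_ne hik.symm, update_of_ne hjk.symm, update_comm hik,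
    update_comm hjk]
  ring

/-- The basis vector of `⊗_{k : ι} ℂ²` indexed by `s`. -/
def ket (s : ι → Fin 2) : (ι → Fin 2) → ℂ := Pi.single s 1

theorem mulVec_ket (X : Matrix (ι → Fin 2) (ι → Fin 2) ℂ) (s t : ι → Fin 2) :
    (X *ᵥ ket s) t = X t s := by
  simp [ket]

theorem siteOp_mulVec_ket (i : ι) (A : Matrix (Fin 2) (Fin 2) ℂ) (s : ι → Fin 2) :
    siteOp i A *ᵥ ket s = ∑ a, A a (s i) • ket (update s i a) := by
  funext t
  rw [mulVec_ket]
  simp only [siteOp, Finset.sum_apply, Pi.smul_apply, ket, Pi.single_apply, smul_eq_mul, mul_ite,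
    mul_one, mul_zero]
  by_cases h : ∀ k, k ≠ i → t k = s k
  · rw [if_pos h, Finset.sum_eq_single (t i)]
    · rw [if_pos]
      funext k
      rcases eq_or_ne k i with rfl | hk
      · simp
      · simp [hk, h k hk]
    · intro b _ hb
      rw [if_neg]
      rintro rfl
      simp at hb
    · simp
  · rw [if_neg h, Finset.sum_eq_zero]
    intro a _
    rw [if_neg]
    rintro rfl
    exact h fun k hk => by simp [hk]

theorem actOnPair_mulVec_ket_of_eq {i j : ι} (hij : i ≠ j)
    {X : Matrix (Fin 2 × Fin 2) (Fin 2 × Fin 2) ℂ} {s : ι → Fin 2} {z : ℂ}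
    (h : ∀ x, X x (s i, s j) = if x = (s i, s j) then z else 0) :
    actOnPair X i j *ᵥ ket s = z • ket s := by
  funext t
  rw [mulVec_ket]
  simp only [actOnPair, Pi.smul_apply, ket, Pi.single_apply, smul_eq_mul, mul_ite, mul_one,
    mul_zero, h]
  by_cases hts : t = s
  · simp [hts]
  · rw [if_neg hts]
    split_ifs with h1 h2
    · refine absurd (funext fun k => ?_) hts
      rcases eq_or_ne k i with rfl | hki
      · exact congrArg Prod.fst h2
      rcases eq_or_ne k j with rfl | hkj
      · exact congrArg Prod.snd h2
      exact h1 k hki hkj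
    all_goals rfl

end SiteOperators

namespace SixVertexWeights

/-! ### Unitarity and Yang-Baxter transported to arbitrary sites. -/

section Relations

variable {Λ : Type*} (W : SixVertexWeights Λ)

theorem R_zero_left (u v : Λ) (b d : Fin 2) :
    W.R u v (0, b) (0, d) = !![1, 0; 0, W.bPlus u v] b d := by
  fin_cases b <;> fin_cases d <;> rfl

theorem R_one_left (u v : Λ) (b d : Fin 2) :
    W.R u v (1, b) (1, d) = !![W.bMinus u v, 0; 0, W.aMinus u v] b d := by
  fin_cases b <;> fin_cases d <;> rfl

theorem R_zero_one (u v : Λ) (b d : Fin 2) :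
    W.R u v (0, b) (1, d) = !![0, 0; W.cPlus u v, 0] b d := by
  fin_cases b <;> fin_cases d <;> rfl

theorem R_one_zero (u v : Λ) (b d : Fin 2) :
    W.R u v (1, b) (0, d) = !![0, W.cMinus u v; 0, 0] b d := by
  fin_cases b <;> fin_cases d <;> rfl

variable {ι : Type*} [Fintype ι] [DecidableEq ι]

/-- The `R`-matrix acting on the sites `i`, `j` with their inhomogeneities. -/
noncomputable def Rop (ξ : ι → Λ) (i j : ι) : Matrix (ι → Fin 2) (ι → Fin 2) ℂ :=
  actOnPair (W.R (ξ i) (ξ j)) i j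

/-- The entries, in the auxiliary space, of the `R`-matrix acting on the auxiliary space and the
site `i`. -/
noncomputable def Lop (ξ : ι → Λ) (u : Λ) (i : ι) :
    Matrix (Fin 2) (Fin 2) (Matrix (ι → Fin 2) (ι → Fin 2) ℂ) :=
  fun a b => siteOp i (Matrix.of fun s t => W.R u (ξ i) (a, s) (b, t))

variable {W}

theorem IsUnitary.Rop_mul_Rop (hU : W.IsUnitary) (ξ : ι → Λ) {i j : ι} (hij : i ≠ j) :
    W.Rop ξ i j * W.Rop ξ j i = 1 := by
  refine matrix_ext_mulVec fun v => ?_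
  rw [← mulVec_mulVec, one_mulVec]
  funext s
  have h := congrFun (congrArg (· *ᵥ (fun r : Fin 2 → Fin 2 => v (update (update s i (r 0)) j (r 1))))
    (hU (ξ i) (ξ j))) ![s i, s j]
  simp only [← mulVec_mulVec, one_mulVec] at h
  rw [actOnPair_mulVec (by decide), actOnPair_mulVec (by decide)] at h
  simp only [Rop]
  rw [actOnPair_mulVec hij, actOnPair_mulVec hij.symm]
  simp [Fin.sum_univ_two, hij, update_comm hij.symm] at h ⊢
  exact h

/-- This is Yang-Baxter with the first of its three spaces taken as auxiliary space and read
entrywise there. -/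
theorem YangBaxter.Lop_mul_Lop (hYB : W.YangBaxter) (ξ : ι → Λ) (u : Λ) {i j : ι} (hij : i ≠ j)
    (a b : Fin 2) :
    (W.Lop ξ u i * W.Lop ξ u j) a b * W.Rop ξ i j =
      W.Rop ξ i j * (W.Lop ξ u j * W.Lop ξ u i) a b := by
  refine matrix_ext_mulVec fun v => ?_
  rw [← mulVec_mulVec, ← mulVec_mulVec]
  funext s
  -- The test vector selects the auxiliary value `b` and copies `v` on the two sites; its component
  -- at auxiliary value `a` is the `(a, b)` entry.
  have h := congrFun (congrArg (· *ᵥ (fun r : Fin 3 → Fin 2 =>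
    if r 0 = b then v (update (update s i (r 1)) j (r 2)) else 0))
    (hYB u (ξ i) (ξ j))) ![a, s i, s j]
  simp only [← mulVec_mulVec] at h
  simp only [actOnPair_mulVec (show (0 : Fin 3) ≠ 1 by decide),
    actOnPair_mulVec (show (0 : Fin 3) ≠ 2 by decide),
    actOnPair_mulVec (show (1 : Fin 3) ≠ 2 by decide), Fin.sum_univ_two] at h
  simp only [Rop, Lop, Matrix.mul_apply (α := Matrix (ι → Fin 2) (ι → Fin 2) ℂ), Fin.sum_univ_two,
    add_mulVec, mulVec_add, ← mulVec_mulVec]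
  simp only [actOnPair_mulVec hij, siteOp_mulVec, Matrix.of_apply, Pi.add_apply, Fin.sum_univ_two]
  fin_cases a <;> fin_cases b <;>
  simp [hij.symm, hij, update_comm hij.symm] at h ⊢ <;> linear_combination h

end Relations

section Projectors

variable {ι : Type*} [Fintype ι] [DecidableEq ι]

/-- The projector onto the states with a `0` at the site `i`. -/
def zeroAt (i : ι) : Matrix (ι → Fin 2) (ι → Fin 2) ℂ := siteOp i (Matrix.single 0 0 1)

/-- The projector onto the states with a `1` at the site `i`. -/
def oneAt (i : ι) : Matrix (ι → Fin 2) (ι → Fin 2) ℂ := siteOp i (Matrix.single 1 1 1)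

theorem zeroAt_add_oneAt (i : ι) :
    (zeroAt i + oneAt i : Matrix (ι → Fin 2) (ι → Fin 2) ℂ) = 1 := by
  refine matrix_ext_mulVec fun v => ?_
  funext s
  rw [zeroAt, oneAt, add_mulVec, one_mulVec]
  simp only [Pi.add_apply, siteOp_mulVec, Fin.sum_univ_two]
  have h : v s = v (update s i (s i)) := by simp
  rw [h]
  generalize s i = c
  fin_cases c <;> simp [Matrix.single]

end Projectors

/-! ### Monodromy matrices over lists of sites, and their reordering. -/

section Monodromy

variable {Λ ι : Type*} [Fintype ι] [DecidableEq ι] {W : SixVertexWeights Λ} {ξ : ι → Λ}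

variable (W ξ) in
/-- The entries, in the auxiliary space, of the monodromy matrix over the sites of a list, the
first of which acts first. -/
noncomputable def mono (u : Λ) (w : List ι) :
    Matrix (Fin 2) (Fin 2) (Matrix (ι → Fin 2) (ι → Fin 2) ℂ) :=
  (w.map (W.Lop ξ u)).reverse.prod

theorem mono_nil (u : Λ) : W.mono ξ u [] = 1 := rfl

theorem mono_append (u : Λ) (v w : List ι) :
    W.mono ξ u (v ++ w) = W.mono ξ u w * W.mono ξ u v := by
  simp [mono]

theorem mono_singleton (u : Λ) (i : ι) : W.mono ξ u [i] = W.Lop ξ u i := by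
  simp [mono]

theorem mono_cons (u : Λ) (i : ι) (w : List ι) :
    W.mono ξ u (i :: w) = W.mono ξ u w * W.Lop ξ u i := by
  simp [mono]

theorem mono_cons_apply (u : Λ) (i : ι) (w : List ι) (a b : Fin 2) :
    W.mono ξ u (i :: w) a b =
      W.mono ξ u w a 0 * W.Lop ξ u i 0 b + W.mono ξ u w a 1 * W.Lop ξ u i 1 b := by
  rw [mono_cons, Matrix.mul_apply, Fin.sum_univ_two]

theorem mono_concat_apply (u : Λ) (i : ι) (w : List ι) (a b : Fin 2) :
    W.mono ξ u (w ++ [i]) a b =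
      W.Lop ξ u i a 0 * W.mono ξ u w 0 b + W.Lop ξ u i a 1 * W.mono ξ u w 1 b := by
  rw [mono_append, mono_singleton, Matrix.mul_apply, Fin.sum_univ_two]

theorem commute_mono {X : Matrix (ι → Fin 2) (ι → Fin 2) ℂ} {u : Λ} {w : List ι}
    (h : ∀ i ∈ w, ∀ a b, Commute X (W.Lop ξ u i a b)) (a b : Fin 2) :
    Commute X (W.mono ξ u w a b) := by
  induction w generalizing b with
  | nil =>
    rw [mono_nil, Matrix.one_apply]
    split_ifs
    · exact Commute.one_right X
    · exact Commute.zero_right X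
  | cons i w ih =>
    have ih' := fun b => ih (fun j hj => h j (List.mem_cons_of_mem i hj)) b
    have hi := h i List.mem_cons_self
    rw [mono_cons_apply]
    exact ((ih' 0).mul_right (hi _ _)).add_right ((ih' 1).mul_right (hi _ _))

theorem siteOp_commute_mono {i : ι} (A : Matrix (Fin 2) (Fin 2) ℂ) (u : Λ) {w : List ι}
    (hi : i ∉ w) (a b : Fin 2) : Commute (siteOp i A) (W.mono ξ u w a b) :=
  commute_mono (fun j hj _ _ => siteOp_commute (by rintro rfl; exact hi hj) _ _) a b

theorem Rop_commute_mono {i j : ι} (hij : i ≠ j) (u : Λ) {w : List ι} (hi : i ∉ w) (hj : j ∉ w)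
    (a b : Fin 2) : Commute (W.Rop ξ i j) (W.mono ξ u w a b) :=
  commute_mono (fun k hk _ _ => actOnPair_commute_siteOp hij (by rintro rfl; exact hi hk)
    (by rintro rfl; exact hj hk) _ _) a b

/-- Turns an entrywise intertwining relation into one identity of matrices over the operator ring,
where products of Lax matrices can simply be reassociated. -/
theorem diagonal_const_comm_iff {𝓐 : Type*} [Ring 𝓐] {X : 𝓐} {M N : Matrix (Fin 2) (Fin 2) 𝓐} :
    M * Matrix.diagonal (fun _ => X) = Matrix.diagonal (fun _ => X) * N ↔
      ∀ a b, M a b * X = X * N a b := by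
  simp [← Matrix.ext_iff]

/-- The R-matrix commutes with the Lax operators of the sites in `p` and `q`, and
`YangBaxter.Lop_mul_Lop` passes it through the two exchanged factors. -/
theorem YangBaxter.mono_swap (hYB : W.YangBaxter) (u : Λ) {p q : List ι} {i j : ι}
    (h : (p ++ i :: j :: q).Nodup) (a b : Fin 2) :
    W.mono ξ u (p ++ i :: j :: q) a b * W.Rop ξ j i =
      W.Rop ξ j i * W.mono ξ u (p ++ j :: i :: q) a b := by
  have hij : j ≠ i := by rintro rfl; simp [List.nodup_append] at h
  have hp : i ∉ p ∧ j ∉ p := by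
    constructor <;> intro hm <;> simp [List.nodup_append] at h <;> grind
  have hq : i ∉ q ∧ j ∉ q := by
    constructor <;> intro hm <;> simp [List.nodup_append] at h <;> grind
  revert a b
  rw [← diagonal_const_comm_iff]
  have e1 := diagonal_const_comm_iff.2 fun a b =>
    (Rop_commute_mono (W := W) (ξ := ξ) hij u hp.2 hp.1 a b).eq.symm
  have e2 := diagonal_const_comm_iff.2 fun a b =>
    (Rop_commute_mono (W := W) (ξ := ξ) hij u hq.2 hq.1 a b).eq.symm
  have e3 := diagonal_const_comm_iff.2 (hYB.Lop_mul_Lop ξ u hij)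
  simp only [mono_append, mono_cons, Matrix.mul_assoc] at e3 ⊢
  rw [e1]
  have e4 : W.Lop ξ u j * (W.Lop ξ u i * (Matrix.diagonal (fun _ => W.Rop ξ j i) * W.mono ξ u p)) =
      Matrix.diagonal (fun _ => W.Rop ξ j i) * (W.Lop ξ u i * (W.Lop ξ u j * W.mono ξ u p)) := by
    simpa only [Matrix.mul_assoc] using congrArg (· * W.mono ξ u p) e3
  rw [e4]
  simp only [← Matrix.mul_assoc]
  rw [e2]

variable (W ξ) in
/-- The operator `R_{q₁ l} R_{q₂ l} ⋯`, which intertwines the monodromy matrix in which `l` precedes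
the sites `q₁, q₂, …` with the one in which it follows them. -/
noncomputable def Xop (l : ι) : List ι → Matrix (ι → Fin 2) (ι → Fin 2) ℂ
  | [] => 1
  | q :: w => W.Rop ξ q l * Xop l w

variable (W ξ) in
/-- The inverse `⋯ R_{l q₂} R_{l q₁}` of `Xop`. -/
noncomputable def Yop (l : ι) : List ι → Matrix (ι → Fin 2) (ι → Fin 2) ℂ
  | [] => 1
  | q :: w => Yop l w * W.Rop ξ l q

theorem IsUnitary.Yop_mul_Xop (hU : W.IsUnitary) {l : ι} {w : List ι} (hl : l ∉ w) :
    W.Yop ξ l w * W.Xop ξ l w = 1 := by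
  induction w with
  | nil => simp [Yop, Xop]
  | cons q w ih =>
    rw [List.mem_cons, not_or] at hl
    rw [Yop, Xop, mul_assoc, ← mul_assoc (W.Rop ξ l q), hU.Rop_mul_Rop ξ hl.1, one_mul, ih hl.2]

theorem IsUnitary.Xop_mul_Yop (hU : W.IsUnitary) {l : ι} {w : List ι} (hl : l ∉ w) :
    W.Xop ξ l w * W.Yop ξ l w = 1 :=
  mul_eq_one_comm.1 (hU.Yop_mul_Xop hl)

theorem siteOp_commute_Xop {l k : ι} (A : Matrix (Fin 2) (Fin 2) ℂ) {w : List ι} (hl : l ∉ w)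
    (hkl : k ≠ l) (hk : k ∉ w) : Commute (siteOp k A) (W.Xop ξ l w) := by
  induction w with
  | nil => exact Commute.one_right _
  | cons q w ih =>
    rw [List.mem_cons, not_or] at hl hk
    exact (actOnPair_commute_siteOp (Ne.symm hl.1) (Ne.symm hk.1) hkl.symm _ A).symm.mul_right
      (ih hl.2 hk.2)

theorem YangBaxter.mono_move (hYB : W.YangBaxter) (u : Λ) {p w z : List ι} {l : ι}
    (h : (p ++ l :: w ++ z).Nodup) (a b : Fin 2) :
    W.mono ξ u (p ++ l :: w ++ z) a b * W.Xop ξ l w =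
      W.Xop ξ l w * W.mono ξ u (p ++ w ++ l :: z) a b := by
  induction w generalizing p with
  | nil => simp [Xop]
  | cons q w ih =>
    have h' : (p ++ l :: q :: (w ++ z)).Nodup := by simpa using h
    have h1 := hYB.mono_swap (ξ := ξ) u h' a b
    have h2 := ih (p := p ++ [q]) (by
      refine h.perm ?_
      simp only [List.append_assoc, List.cons_append, List.nil_append]
      exact List.Perm.append_left _ (List.Perm.swap _ _ _))
    simp only [Xop, List.append_assoc, List.cons_append, List.nil_append] at h1 h2 ⊢
    rw [← mul_assoc, h1, mul_assoc, h2, mul_assoc]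

/-- Once the outgoing and incoming values at `i` are fixed, `i` plays the role of an auxiliary space
with spectral parameter `ξ i`. -/
theorem actOnPair_single_expansion {i j : ι} (hij : i ≠ j) (g β : Fin 2) :
    siteOp i (Matrix.single g g 1) * W.Rop ξ i j * siteOp i (Matrix.single β β 1) =
      siteOp i (Matrix.single g β 1) * W.Lop ξ (ξ i) j g β := by
  refine matrix_ext_mulVec fun v => ?_
  simp only [← mulVec_mulVec]
  funext s
  simp only [Rop, Lop, siteOp_mulVec, actOnPair_mulVec hij, Matrix.of_apply, Fin.sum_univ_two,
    update_self, update_of_ne hij, update_of_ne hij.symm, update_idem]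
  have e : ∀ x y z : Fin 2, update (update (update s i x) j y) i z = update (update s i z) j y :=
    fun x y z => by rw [update_comm hij.symm, update_idem]
  generalize s i = c
  fin_cases g <;> fin_cases β <;> fin_cases c <;> simp [Matrix.single, e]

/-- `Yop l w` is the monodromy matrix over `w` whose auxiliary space is the site `l`. -/
theorem siteOp_mul_Yop_mul_siteOp {l : ι} {w : List ι} (hl : l ∉ w) (α β : Fin 2) :
    siteOp l (Matrix.single α α 1) * W.Yop ξ l w * siteOp l (Matrix.single β β 1) =
      siteOp l (Matrix.single α β 1) * W.mono ξ (ξ l) w α β := by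
  induction w generalizing β with
  | nil =>
    rw [mono_nil, Yop, mul_one, siteOp_mul_self]
    by_cases h : α = β
    · subst h; simp
    · simp [h, siteOp_zero]
  | cons q w ih =>
    rw [List.mem_cons, not_or] at hl
    -- The resolution of the identity is written with squared projectors: one copy serves the
    -- induction hypothesis on the left, the other the expansion of the R-matrix on the right.
    have e : (1 : Matrix (ι → Fin 2) (ι → Fin 2) ℂ) =
        siteOp l (Matrix.single 0 0 1) * siteOp l (Matrix.single 0 0 1) +
          siteOp l (Matrix.single 1 1 1) * siteOp l (Matrix.single 1 1 1) := by
      rw [siteOp_mul_self, siteOp_mul_self, Matrix.single_mul_single_same,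
        Matrix.single_mul_single_same, mul_one]
      exact (zeroAt_add_oneAt l).symm
    have key : ∀ g, siteOp l (Matrix.single α α 1) * W.Yop ξ l w *
        (siteOp l (Matrix.single g g 1) * siteOp l (Matrix.single g g 1)) * W.Rop ξ l q *
          siteOp l (Matrix.single β β 1) =
        siteOp l (Matrix.single α β 1) * (W.mono ξ (ξ l) w α g * W.Lop ξ (ξ l) q g β) := by
      intro g
      rw [← mul_assoc, ih hl.2 g]
      simp only [mul_assoc]
      rw [← mul_assoc (siteOp l (Matrix.single g g 1)) (W.Rop ξ l q),
        actOnPair_single_expansion hl.1,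
        ← mul_assoc (W.mono ξ (ξ l) w α g), ← (siteOp_commute_mono _ _ hl.2 _ _).eq,
        ← mul_assoc, ← mul_assoc, siteOp_mul_self]
      simp [mul_assoc]
    rw [Yop, ← mul_assoc, ← mul_one (siteOp l (Matrix.single α α 1) * W.Yop ξ l w), e, mul_add,
      add_mul, add_mul, key, key, mono_cons_apply, mul_add]

end Monodromy

/-! ### Action on basis states. -/

section Kets

variable {Λ ι : Type*} [Fintype ι] [DecidableEq ι] {W : SixVertexWeights Λ} {ξ : ι → Λ}

theorem Lop_zero_zero_ket (u : Λ) {i : ι} {s : ι → Fin 2} (h : s i = 1) :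
    W.Lop ξ u i 0 0 *ᵥ ket s = W.bPlus u (ξ i) • ket s := by
  have hs : update s i 1 = s := by rw [← h, update_eq_self]
  rw [Lop, siteOp_mulVec_ket, Fin.sum_univ_two, h]
  simp [R_zero_left, hs]

theorem Lop_zero_one_ket (u : Λ) {i : ι} {s : ι → Fin 2} (h : s i = 1) :
    W.Lop ξ u i 0 1 *ᵥ ket s = 0 := by
  rw [Lop, siteOp_mulVec_ket, Fin.sum_univ_two, h]
  simp [R_zero_one]

theorem Lop_one_zero_ket (u : Λ) {i : ι} {s : ι → Fin 2} (h : s i = 1) :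
    W.Lop ξ u i 1 0 *ᵥ ket s = W.cMinus u (ξ i) • ket (update s i 0) := by
  rw [Lop, siteOp_mulVec_ket, Fin.sum_univ_two, h]
  simp [R_one_zero]

theorem Lop_one_one_ket (u : Λ) {i : ι} {s : ι → Fin 2} (h : s i = 1) :
    W.Lop ξ u i 1 1 *ᵥ ket s = W.aMinus u (ξ i) • ket s := by
  have hs : update s i 1 = s := by rw [← h, update_eq_self]
  rw [Lop, siteOp_mulVec_ket, Fin.sum_univ_two, h]
  simp [R_one_left, hs]

theorem Lop_zero_one_ket_of_zero (u : Λ) {i : ι} {s : ι → Fin 2} (h : s i = 0) :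
    W.Lop ξ u i 0 1 *ᵥ ket s = W.cPlus u (ξ i) • ket (update s i 1) := by
  rw [Lop, siteOp_mulVec_ket, Fin.sum_univ_two, h]
  simp [R_zero_one]

theorem zeroAt_ket {i : ι} {s : ι → Fin 2} (h : s i = 0) : zeroAt i *ᵥ ket s = ket s := by
  have hs : update s i 0 = s := by rw [← h, update_eq_self]
  rw [zeroAt, siteOp_mulVec_ket, Fin.sum_univ_two, h]
  simp [hs, Matrix.single]

theorem oneAt_ket {i : ι} {s : ι → Fin 2} (h : s i = 1) : oneAt i *ᵥ ket s = ket s := by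
  have hs : update s i 1 = s := by rw [← h, update_eq_self]
  rw [oneAt, siteOp_mulVec_ket, Fin.sum_univ_two, h]
  simp [hs, Matrix.single]

theorem apply_eq_zero_of_oneAt {i : ι} {v : (ι → Fin 2) → ℂ} (hv : oneAt i *ᵥ v = v)
    {t : ι → Fin 2} (ht : t i = 0) : v t = 0 := by
  rw [← hv, oneAt, siteOp_mulVec]
  simp [ht, Matrix.single]

theorem Lop_one_one_mul_zeroAt (u : Λ) (i : ι) :
    W.Lop ξ u i 1 1 * zeroAt i = W.bMinus u (ξ i) • zeroAt i := by
  rw [zeroAt, Lop, siteOp_mul_self, ← siteOp_smul]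
  congr 1
  ext a b
  fin_cases a <;> fin_cases b <;> simp [Matrix.mul_apply, Matrix.single, R_one_left]

theorem Lop_one_zero_mul_zeroAt (u : Λ) (i : ι) : W.Lop ξ u i 1 0 * zeroAt i = 0 := by
  rw [zeroAt, Lop, siteOp_mul_self, ← siteOp_zero i]
  congr 1
  ext a b
  fin_cases a <;> fin_cases b <;> simp [Matrix.mul_apply, Matrix.single, R_one_zero]

theorem mono_zero_one_ket (u : Λ) {w : List ι} {s : ι → Fin 2} (h : ∀ i ∈ w, s i = 1) :
    W.mono ξ u w 0 1 *ᵥ ket s = 0 := by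
  induction w with
  | nil => simp [mono_nil]
  | cons i w ih =>
    have hi := h i List.mem_cons_self
    rw [mono_cons_apply, add_mulVec, ← mulVec_mulVec, ← mulVec_mulVec, Lop_zero_one_ket u hi,
      Lop_one_one_ket u hi, mulVec_zero, mulVec_smul,
      ih fun j hj => h j (List.mem_cons_of_mem i hj), smul_zero, add_zero]

theorem mono_one_one_ket (u : Λ) {w : List ι} {s : ι → Fin 2} (h : ∀ i ∈ w, s i = 1) :
    W.mono ξ u w 1 1 *ᵥ ket s = (w.map fun i => W.aMinus u (ξ i)).prod • ket s := by
  induction w with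
  | nil => simp [mono_nil]
  | cons i w ih =>
    have hi := h i List.mem_cons_self
    rw [mono_cons_apply, add_mulVec, ← mulVec_mulVec, ← mulVec_mulVec, Lop_zero_one_ket u hi,
      Lop_one_one_ket u hi, mulVec_zero, mulVec_smul,
      ih fun j hj => h j (List.mem_cons_of_mem i hj), zero_add, smul_smul, List.map_cons,
      List.prod_cons]

theorem mono_zero_zero_ket (u : Λ) {w : List ι} (hw : w.Nodup) {s : ι → Fin 2}
    (h : ∀ i ∈ w, s i = 1) :
    W.mono ξ u w 0 0 *ᵥ ket s = (w.map fun i => W.bPlus u (ξ i)).prod • ket s := by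
  induction w with
  | nil => simp [mono_nil]
  | cons i w ih =>
    have hi := h i List.mem_cons_self
    rw [List.nodup_cons] at hw
    have h' : ∀ j ∈ w, update s i 0 j = 1 := fun j hj => by
      rw [update_of_ne (by rintro rfl; exact hw.1 hj), h j (List.mem_cons_of_mem i hj)]
    rw [mono_cons_apply, add_mulVec, ← mulVec_mulVec, ← mulVec_mulVec, Lop_zero_zero_ket u hi,
      Lop_one_zero_ket u hi, mulVec_smul, mulVec_smul, mono_zero_one_ket u h',
      ih hw.2 fun j hj => h j (List.mem_cons_of_mem i hj), smul_zero, add_zero, smul_smul,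
      List.map_cons, List.prod_cons]

theorem Rop_ket_one {i j : ι} (hij : i ≠ j) {s : ι → Fin 2} (hi : s i = 1) (hj : s j = 1) :
    W.Rop ξ i j *ᵥ ket s = W.aMinus (ξ i) (ξ j) • ket s := by
  refine actOnPair_mulVec_ket_of_eq hij fun x => ?_
  rw [hi, hj]
  obtain ⟨x, y⟩ := x
  fin_cases x <;> fin_cases y <;> rfl

theorem Rop_ket_zero {i j : ι} (hij : i ≠ j) {s : ι → Fin 2} (hi : s i = 0) (hj : s j = 0) :
    W.Rop ξ i j *ᵥ ket s = ket s := by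
  rw [← one_smul ℂ (ket s), mulVec_smul, one_smul]
  refine actOnPair_mulVec_ket_of_eq hij fun x => ?_
  rw [hi, hj]
  obtain ⟨x, y⟩ := x
  fin_cases x <;> fin_cases y <;> rfl

theorem Xop_ket_one {l : ι} {w : List ι} (hl : l ∉ w) {s : ι → Fin 2} (hsl : s l = 1)
    (h : ∀ i ∈ w, s i = 1) :
    W.Xop ξ l w *ᵥ ket s = (w.map fun q => W.aMinus (ξ q) (ξ l)).prod • ket s := by
  induction w with
  | nil => simp [Xop]
  | cons q w ih =>
    rw [List.mem_cons, not_or] at hl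
    rw [Xop, ← mulVec_mulVec, ih hl.2 fun j hj => h j (List.mem_cons_of_mem q hj), mulVec_smul,
      Rop_ket_one (Ne.symm hl.1) (h q List.mem_cons_self) hsl, smul_smul, List.map_cons,
      List.prod_cons, mul_comm]

theorem Yop_ket_one {l : ι} {w : List ι} (hl : l ∉ w) {s : ι → Fin 2} (hsl : s l = 1)
    (h : ∀ i ∈ w, s i = 1) :
    W.Yop ξ l w *ᵥ ket s = (w.map fun q => W.aMinus (ξ l) (ξ q)).prod • ket s := by
  induction w with
  | nil => simp [Yop]
  | cons q w ih =>
    rw [List.mem_cons, not_or] at hl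
    rw [Yop, ← mulVec_mulVec, Rop_ket_one hl.1 hsl (h q List.mem_cons_self), mulVec_smul,
      ih hl.2 fun j hj => h j (List.mem_cons_of_mem q hj), smul_smul, List.map_cons,
      List.prod_cons]

/-- With a 1 entering at `l`, the site `l` leaves as 1 or 0, and `Yop` acts accordingly as the D or
B operator at spectral parameter `ξ l`. This is how `Yop` is evaluated on excitations. -/
theorem Yop_mulVec {l : ι} {w : List ι} (hl : l ∉ w) {v : (ι → Fin 2) → ℂ}
    (hv : oneAt l *ᵥ v = v) :
    W.Yop ξ l w *ᵥ v = W.mono ξ (ξ l) w 1 1 *ᵥ v +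
      siteOp l (Matrix.single 0 1 1) *ᵥ W.mono ξ (ξ l) w 0 1 *ᵥ v := by
  have h0 := congrArg (· *ᵥ v) (siteOp_mul_Yop_mul_siteOp (W := W) (ξ := ξ) hl 0 1)
  have h1 := congrArg (· *ᵥ v) ((siteOp_mul_Yop_mul_siteOp (W := W) (ξ := ξ) hl 1 1).trans
    (siteOp_commute_mono (Matrix.single 1 1 1) (ξ l) hl 1 1).eq)
  simp only [← mulVec_mulVec] at h0 h1
  change zeroAt l *ᵥ W.Yop ξ l w *ᵥ oneAt l *ᵥ v = _ at h0
  change oneAt l *ᵥ W.Yop ξ l w *ᵥ oneAt l *ᵥ v = W.mono ξ (ξ l) w 1 1 *ᵥ oneAt l *ᵥ v at h1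
  rw [hv] at h0 h1
  rw [← one_mulVec (W.Yop ξ l w *ᵥ v), ← zeroAt_add_oneAt l, add_mulVec, h0, h1, add_comm]

/-- When the factor `R_{q l}` acts, `q` still carries its 1. Hence only the diagonal entry b₋ can
contribute, the exchange term requiring a 0 at `q`. -/
theorem Xop_ket_update_apply {l : ι} {w : List ι} (hw : (l :: w).Nodup) {s : ι → Fin 2}
    (h : ∀ i ∈ w, s i = 1) :
    (W.Xop ξ l w *ᵥ ket (update s l 0)) (update s l 0) =
      (w.map fun q => W.bMinus (ξ q) (ξ l)).prod := by
  induction w with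
  | nil => simp [Xop, ket]
  | cons q w ih =>
    have hlq : l ≠ q := by rintro rfl; simp at hw
    have hl : l ∉ w := by intro hm; simp [hm] at hw
    have hq : q ∉ w := by intro hm; simp [hm] at hw
    have ih' := ih (List.nodup_cons.2 ⟨hl, by simp at hw; tauto⟩)
      fun j hj => h j (List.mem_cons_of_mem q hj)
    have hs : s q = 1 := h q List.mem_cons_self
    have hone : oneAt q *ᵥ (W.Xop ξ l w *ᵥ ket (update s l 0)) =
        W.Xop ξ l w *ᵥ ket (update s l 0) := by
      rw [mulVec_mulVec, oneAt, (siteOp_commute_Xop _ hl hlq.symm hq).eq, ← mulVec_mulVec]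
      change _ *ᵥ oneAt q *ᵥ _ = _
      rw [oneAt_ket (by rw [update_of_ne hlq.symm, hs])]
    rw [Xop, ← mulVec_mulVec, Rop, actOnPair_mulVec hlq.symm]
    have e0 : (W.Xop ξ l w *ᵥ ket (update s l 0))
        (update (update (update s l 0) q 0) l 1) = 0 :=
      apply_eq_zero_of_oneAt hone (by simp [hlq.symm])
    have e1 : update (update (update s l 0) q 1) l 0 = update s l 0 := by
      rw [update_comm hlq.symm, update_idem, update_eq_iff]
      exact ⟨by rw [update_of_ne hlq.symm, hs], fun _ _ => rfl⟩
    simp only [Fin.sum_univ_two, update_self, update_of_ne hlq.symm, hs, R_one_left, R_one_zero,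
      e0, e1, ih', List.map_cons, List.prod_cons]
    simp

end Kets

end SixVertexWeights

/-! ### Sorted lists of sites split at one element. -/

section SortedLists

variable {ι : Type*} [LinearOrder ι]

theorem Finset.sort_eq_append {S : Finset ι} {l : ι} (hl : l ∈ S) :
    S.sort = (S.filter (· < l)).sort ++ l :: (S.filter (l < ·)).sort := by
  set L := (S.filter (· < l)).sort ++ l :: (S.filter (l < ·)).sort with hL
  have hnd : L.Nodup := by
    simp only [hL, List.nodup_append, List.nodup_cons, Finset.sort_nodup, Finset.mem_sort,
      Finset.mem_filter, List.mem_cons]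
    grind
  have hpw : L.Pairwise (· ≤ ·) := by
    simp only [hL, List.pairwise_append, List.pairwise_cons, Finset.pairwise_sort,
      Finset.mem_sort, Finset.mem_filter, List.mem_cons]
    grind
  have hS : L.toFinset = S := by
    ext x
    simp only [hL, List.mem_toFinset, List.mem_append, List.mem_cons, Finset.mem_sort,
      Finset.mem_filter]
    grind
  rw [← (List.toFinset_sort (r := (· ≤ ·)) hnd).2 hpw, hS]

theorem Finset.sort_erase_eq_append (S : Finset ι) (l : ι) :
    (S.erase l).sort = (S.filter (· < l)).sort ++ (S.filter (l < ·)).sort := by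
  set L := (S.filter (· < l)).sort ++ (S.filter (l < ·)).sort with hL
  have hnd : L.Nodup := by
    simp only [hL, List.nodup_append, Finset.sort_nodup, Finset.mem_sort, Finset.mem_filter]
    grind
  have hpw : L.Pairwise (· ≤ ·) := by
    simp only [hL, List.pairwise_append, Finset.pairwise_sort, Finset.mem_sort,
      Finset.mem_filter]
    grind
  have hS : L.toFinset = S.erase l := by
    ext x
    simp only [hL, List.mem_toFinset, List.mem_append, Finset.mem_sort, Finset.mem_filter,
      Finset.mem_erase]
    grind
  rw [← (List.toFinset_sort (r := (· ≤ ·)) hnd).2 hpw, hS]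

theorem Finset.prod_map_sort (S : Finset ι) (f : ι → ℂ) :
    (S.sort.map f).prod = ∏ i ∈ S, f i := by
  rw [Finset.prod, ← Finset.sort_eq S (· ≤ ·), Multiset.map_coe, Multiset.prod_coe]

end SortedLists

namespace SixVertexWeights

/-! ### Expansion of C(u) on an all-ones state. -/

section SingleExcitation

variable {Λ ι : Type*} [Fintype ι] [LinearOrder ι] {W : SixVertexWeights Λ} {ξ : ι → Λ}

variable (W ξ) in
/-- `a₋(ξ_i, ξ_j)` if `i < j`, and `1` otherwise. -/
noncomputable def siteTheta (i j : ι) : ℂ := if i < j then W.aMinus (ξ i) (ξ j) else 1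

variable (W ξ) in
/-- The coefficient of `excitation W ξ s S l` in the expansion of `C(u)` applied to a state which
is `1` on `S`. -/
noncomputable def creationCoeff (u : Λ) (S : Finset ι) (l : ι) : ℂ :=
  W.cMinus u (ξ l) *
    ∏ p ∈ S.erase l, W.aMinus u (ξ p) * W.siteTheta ξ p l / W.bMinus (ξ p) (ξ l)

variable (W ξ) in
/-- The state obtained from `s`, which is `1` on `S`, by changing the entry at the site `l ∈ S` to
`0` after moving this site past the subsequent ones. -/
noncomputable def excitation (s : ι → Fin 2) (S : Finset ι) (l : ι) : (ι → Fin 2) → ℂ :=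
  W.Xop ξ l (S.filter (l < ·)).sort *ᵥ ket (update s l 0)

theorem YangBaxter.mono_mul_Xop (hYB : W.YangBaxter) (u : Λ) {S : Finset ι} {l : ι} (hl : l ∈ S)
    (a b : Fin 2) :
    W.mono ξ u S.sort a b * W.Xop ξ l (S.filter (l < ·)).sort =
      W.Xop ξ l (S.filter (l < ·)).sort * W.mono ξ u ((S.erase l).sort ++ [l]) a b := by
  have hs := Finset.sort_eq_append hl
  have h := hYB.mono_move (ξ := ξ) u (p := (S.filter (· < l)).sort)
    (w := (S.filter (l < ·)).sort) (z := []) (l := l) (by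
      rw [List.append_nil, ← hs]; exact Finset.sort_nodup _ _) a b
  rw [List.append_nil, ← hs, ← Finset.sort_erase_eq_append] at h
  exact h

/-- After `l` is moved to the end, D splits into two terms; the one containing B over the other
sites vanishes because these all carry 1, and the other is diagonal. -/
theorem YangBaxter.mono_one_one_excitation (hYB : W.YangBaxter) (u : Λ) {S : Finset ι} {l : ι}
    (hl : l ∈ S) {s : ι → Fin 2} (hs : ∀ i ∈ S, s i = 1) :
    W.mono ξ u S.sort 1 1 *ᵥ W.excitation ξ s S l =
      (W.bMinus u (ξ l) * ∏ p ∈ S.erase l, W.aMinus u (ξ p)) • W.excitation ξ s S l := by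
  have h1 : ∀ i ∈ (S.erase l).sort, update s l 0 i = 1 := fun i hi => by
    rw [Finset.mem_sort, Finset.mem_erase] at hi
    rw [update_of_ne hi.1, hs i hi.2]
  have hz : zeroAt l *ᵥ ket (update s l 0) = ket (update s l 0) := zeroAt_ket (update_self ..)
  have hL : W.Lop ξ u l 1 1 *ᵥ ket (update s l 0) = W.bMinus u (ξ l) • ket (update s l 0) := by
    rw [← hz, mulVec_mulVec, Lop_one_one_mul_zeroAt, smul_mulVec]
  rw [excitation, mulVec_mulVec, hYB.mono_mul_Xop u hl, ← mulVec_mulVec, mono_concat_apply,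
    add_mulVec, ← mulVec_mulVec, ← mulVec_mulVec, mono_zero_one_ket u h1, mono_one_one_ket u h1,
    mulVec_zero, zero_add, mulVec_smul, hL, Finset.prod_map_sort, smul_smul, mulVec_smul, mul_comm]

/-- B refills the only 0, and the remaining `Xop` is scalar on the all-ones state. Only
proportionality is needed, so the scalar stays unnamed. -/
theorem YangBaxter.mono_zero_one_excitation (hYB : W.YangBaxter) (u : Λ) {S : Finset ι} {l : ι}
    (hl : l ∈ S) {s : ι → Fin 2} (hs : ∀ i ∈ S, s i = 1) :
    ∃ z : ℂ, W.mono ξ u S.sort 0 1 *ᵥ W.excitation ξ s S l = z • ket s := by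
  have h1 : ∀ i ∈ (S.erase l).sort, update s l 0 i = 1 := fun i hi => by
    rw [Finset.mem_sort, Finset.mem_erase] at hi
    rw [update_of_ne hi.1, hs i hi.2]
  have hsl : update (update s l 0) l 1 = s := by rw [update_idem, ← hs l hl, update_eq_self]
  rw [excitation, mulVec_mulVec, hYB.mono_mul_Xop u hl, ← mulVec_mulVec, mono_concat_apply,
    add_mulVec, ← mulVec_mulVec, ← mulVec_mulVec, mono_zero_one_ket u h1, mono_one_one_ket u h1,
    mulVec_zero, zero_add, mulVec_smul, Lop_zero_one_ket_of_zero u (update_self ..), hsl,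
    mulVec_smul, mulVec_smul, Xop_ket_one (by simp) (hs l hl) fun i hi => hs i (by
      rw [Finset.mem_sort] at hi
      exact Finset.mem_of_mem_filter i hi), smul_smul, smul_smul]
  exact ⟨_, rfl⟩

theorem oneAt_excitation {S : Finset ι} {a l : ι} (ha : a ∉ S) (hl : l ∈ S) {s : ι → Fin 2}
    (hs : s a = 1) : oneAt a *ᵥ W.excitation ξ s S l = W.excitation ξ s S l := by
  have hal : a ≠ l := by rintro rfl; exact ha hl
  rw [excitation, mulVec_mulVec, oneAt, (siteOp_commute_Xop _ (by simp) hal (by simp [ha])).eq,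
    ← mulVec_mulVec]
  congr 1
  exact oneAt_ket (by rw [update_of_ne hal, hs])

omit [Fintype ι] in
theorem creationCoeff_insert (u : Λ) {S : Finset ι} {a l : ι} (ha : ∀ x ∈ S, a < x)
    (hl : l ∈ S) :
    W.creationCoeff ξ u (insert a S) l =
      W.creationCoeff ξ u S l *
        (W.aMinus u (ξ a) * W.aMinus (ξ a) (ξ l) / W.bMinus (ξ a) (ξ l)) := by
  have haS : a ∉ S := fun h => lt_irrefl a (ha a h)
  have hal : a ≠ l := (ha l hl).ne
  rw [creationCoeff, creationCoeff, Finset.erase_insert_of_ne hal, Finset.prod_insert (by simp [haS]),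
    siteTheta, if_pos (ha l hl)]
  ring

/-- Induction by adjoining a smallest site `a`. The terms with `l ∈ S` are fixed by the induction
hypothesis up to a multiple of a single vector, and that multiple is read off from one component. -/
theorem YangBaxter.mono_one_zero_ket (hYB : W.YangBaxter) (hU : W.IsUnitary)
    (hξ : ∀ i j : ι, i ≠ j → W.bMinus (ξ i) (ξ j) ≠ 0) (u : Λ) (S : Finset ι) {s : ι → Fin 2}
    (hs : ∀ i ∈ S, s i = 1) :
    W.mono ξ u S.sort 1 0 *ᵥ ket s =
      ∑ l ∈ S, W.creationCoeff ξ u S l • W.excitation ξ s S l := by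
  induction S using Finset.induction_on_min with
  | empty => simp [mono_nil]
  | insert a S ha ih =>
    have haS : a ∉ S := fun h => lt_irrefl a (ha a h)
    have hsa : s a = 1 := hs a (Finset.mem_insert_self a S)
    have hsS : ∀ i ∈ S, s i = 1 := fun i hi => hs i (Finset.mem_insert_of_mem hi)
    have hsS' : ∀ i ∈ S.sort, s i = 1 := fun i hi => hsS i ((Finset.mem_sort _).1 hi)
    have haS' : a ∉ S.sort := by simpa using haS
    specialize ih hsS
    have hsort : (insert a S).sort = a :: S.sort :=
      Finset.sort_insert _ (fun b hb => (ha b hb).le) haS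
    have hexc : ∀ l ∈ S, W.excitation ξ s (insert a S) l = W.excitation ξ s S l := by
      intro l hl
      rw [excitation, excitation, Finset.filter_insert, if_neg (ha l hl).not_gt]
    have hexca : W.excitation ξ s (insert a S) a = W.Xop ξ a S.sort *ᵥ ket (update s a 0) := by
      rw [excitation, Finset.filter_insert, if_neg (lt_irrefl a), Finset.filter_true_of_mem ha]
    rw [Finset.sum_insert haS, hexca, Finset.sum_congr rfl fun l hl => by rw [hexc l hl], ← sub_eq_iff_eq_add]
    set D := W.mono ξ u (insert a S).sort 1 0 *ᵥ ket s -
      ∑ l ∈ S, W.creationCoeff ξ u (insert a S) l • W.excitation ξ s S l with hD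
    -- `Yop` moves `a` to the end. On the excitations it acts as D(ξ_a) + σ·B(ξ_a), σ flipping `a`
    -- to 0. The eigenvalue of D cancels the denominator b₋(ξ_a, ξ_l) of the new coefficient, so
    -- these terms cancel by induction; everything else has its single 0 at `a`.
    have hY : ∃ x : ℂ, W.Yop ξ a S.sort *ᵥ D = x • ket (update s a 0) := by
      have hmove : W.Yop ξ a S.sort * W.mono ξ u (a :: S.sort) 1 0 =
          W.mono ξ u (S.sort ++ [a]) 1 0 * W.Yop ξ a S.sort := by
        have h := hYB.mono_move (ξ := ξ) u (p := []) (w := S.sort) (z := []) (l := a) (by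
          simpa using haS) 1 0
        simp only [List.nil_append, List.append_nil] at h
        calc _ = W.Yop ξ a S.sort * (W.mono ξ u (a :: S.sort) 1 0 * W.Xop ξ a S.sort) *
              W.Yop ξ a S.sort := by
              rw [mul_assoc, mul_assoc, hU.Xop_mul_Yop haS', mul_one]
          _ = _ := by rw [h, ← mul_assoc, hU.Yop_mul_Xop haS', one_mul]
      have h1 : W.Yop ξ a S.sort *ᵥ W.mono ξ u (insert a S).sort 1 0 *ᵥ ket s =
          (∏ q ∈ S, W.aMinus (ξ a) (ξ q)) • ((∏ q ∈ S, W.bPlus u (ξ q)) • W.cMinus u (ξ a) •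
            ket (update s a 0) + W.aMinus u (ξ a) • W.mono ξ u S.sort 1 0 *ᵥ ket s) := by
        rw [hsort, mulVec_mulVec, hmove, ← mulVec_mulVec, Yop_ket_one haS' hsa hsS', mulVec_smul,
          Finset.prod_map_sort, mono_concat_apply, add_mulVec, ← mulVec_mulVec,
          mono_zero_zero_ket u (Finset.sort_nodup _ _) hsS', Finset.prod_map_sort, mulVec_smul,
          Lop_one_zero_ket u hsa]
        congr 3
        rw [Lop, (siteOp_commute_mono _ u haS' 1 0).eq, ← mulVec_mulVec]
        change _ *ᵥ W.Lop ξ u a 1 1 *ᵥ ket s = _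
        rw [Lop_one_one_ket u hsa, mulVec_smul]
      choose! z hz using fun (l : ι) (hl : l ∈ S) =>
        hYB.mono_zero_one_excitation (ξ := ξ) (ξ a) hl hsS
      have h2 : ∀ l ∈ S, W.Yop ξ a S.sort *ᵥ W.creationCoeff ξ u (insert a S) l •
          W.excitation ξ s S l =
          ((∏ q ∈ S, W.aMinus (ξ a) (ξ q)) * W.aMinus u (ξ a)) •
            (W.creationCoeff ξ u S l • W.excitation ξ s S l) +
          (W.creationCoeff ξ u (insert a S) l * z l) • ket (update s a 0) := by
        intro l hl
        have hσ : siteOp a (Matrix.single 0 1 1) *ᵥ ket s = ket (update s a 0) := by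
          rw [siteOp_mulVec_ket, Fin.sum_univ_two, hsa]
          simp [Matrix.single]
        have hb := hξ a l (ha l hl).ne
        rw [mulVec_smul, Yop_mulVec haS' (oneAt_excitation haS hl hsa),
          hYB.mono_one_one_excitation (ξ a) hl hsS, hz l hl, mulVec_smul, hσ, smul_add, smul_smul,
          smul_smul, smul_smul, creationCoeff_insert u ha hl, ← Finset.mul_prod_erase S _ hl]
        congr 2
        field_simp
      rw [hD, mulVec_sub, h1, mulVec_sum, Finset.sum_congr rfl h2, Finset.sum_add_distrib,
        ← Finset.smul_sum, ← ih, ← Finset.sum_smul]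
      refine ⟨(∏ q ∈ S, W.aMinus (ξ a) (ξ q)) * ((∏ q ∈ S, W.bPlus u (ξ q)) * W.cMinus u (ξ a)) -
        ∑ l ∈ S, W.creationCoeff ξ u (insert a S) l * z l, ?_⟩
      module
    obtain ⟨x, hx⟩ := hY
    have hDx : D = x • W.Xop ξ a S.sort *ᵥ ket (update s a 0) := by
      rw [← mulVec_smul, ← hx, mulVec_mulVec, hU.Xop_mul_Yop haS', one_mulVec]
    -- Every term with `a` still equal to 1 vanishes on this component, so the remaining multiple
    -- `x` is determined without evaluating the scalars `z l`.
    have hcomp : D (update s a 0) = W.cMinus u (ξ a) * ∏ q ∈ S, W.aMinus u (ξ q) := by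
      have hC : oneAt a *ᵥ W.mono ξ u S.sort 1 0 *ᵥ ket s = W.mono ξ u S.sort 1 0 *ᵥ ket s := by
        rw [mulVec_mulVec, oneAt, (siteOp_commute_mono _ u haS' 1 0).eq, ← mulVec_mulVec]
        congr 1
        exact oneAt_ket hsa
      have h0 := apply_eq_zero_of_oneAt hC (update_self a 0 s)
      have h0' : ∀ l ∈ S, W.excitation ξ s S l (update s a 0) = 0 := fun l hl =>
        apply_eq_zero_of_oneAt (oneAt_excitation haS hl hsa) (update_self a 0 s)
      have h1 : ∀ i ∈ S.sort, update s a 0 i = 1 := fun i hi => by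
        rw [update_of_ne (by rintro rfl; exact haS' hi), hsS' i hi]
      rw [hD, hsort, mono_cons_apply, add_mulVec, ← mulVec_mulVec, ← mulVec_mulVec,
        Lop_zero_zero_ket u hsa, Lop_one_zero_ket u hsa, mulVec_smul, mulVec_smul,
        mono_one_one_ket u h1, Finset.prod_map_sort]
      simp only [Pi.sub_apply, Pi.add_apply, Pi.smul_apply, Finset.sum_apply, h0, smul_eq_mul]
      rw [Finset.sum_eq_zero fun l hl => by rw [h0' l hl, mul_zero]]
      simp [ket]
    have hX := Xop_ket_update_apply (W := W) (ξ := ξ) (List.nodup_cons.2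
      ⟨haS', Finset.sort_nodup S (· ≤ ·)⟩) hsS'
    rw [hDx, Pi.smul_apply, hX, Finset.prod_map_sort, smul_eq_mul] at hcomp
    have hne : ∏ q ∈ S, W.bMinus (ξ q) (ξ a) ≠ 0 :=
      Finset.prod_ne_zero_iff.2 fun q hq => hξ q a (ha q hq).ne'
    rw [hDx]
    congr 1
    rw [eq_div_of_mul_eq hne hcomp, creationCoeff, Finset.erase_insert haS, mul_div_assoc,
      ← Finset.prod_div_distrib]
    congr 1
    refine Finset.prod_congr rfl fun q hq => ?_
    rw [siteTheta, if_neg (ha q hq).not_gt, mul_one]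

end SingleExcitation

/-! ### Products of C operators and covariant families of row vectors. -/

section Creations

variable {Λ ι : Type*} [Fintype ι] [DecidableEq ι] {W : SixVertexWeights Λ} {ξ : ι → Λ}

variable (W ξ) in
/-- The product `C(ν_M) ⋯ C(ν_1)` over the sites of a list. -/
noncomputable def creations (w : List ι) {M : ℕ} (ν : Fin M → Λ) :
    Matrix (ι → Fin 2) (ι → Fin 2) ℂ :=
  (List.ofFn fun m => W.mono ξ (ν m) w 1 0).reverse.prod

theorem creations_zero (w : List ι) (ν : Fin 0 → Λ) : W.creations ξ w ν = 1 := by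
  simp [creations]

theorem creations_succ (w : List ι) {M : ℕ} (ν : Fin (M + 1) → Λ) :
    W.creations ξ w ν = W.creations ξ w (fun m => ν m.succ) * W.mono ξ (ν 0) w 1 0 := by
  simp [creations, List.ofFn_succ]

/-- On a last site carrying 0, the Lax entry (1,0) vanishes and the entry (1,1) is b₋, so each C
passes to the other sites and leaves the 0 in place. -/
theorem creations_concat_mul_zeroAt {w : List ι} {l : ι} (hl : l ∉ w) {M : ℕ} (ν : Fin M → Λ) :
    W.creations ξ (w ++ [l]) ν * zeroAt l =
      (∏ k, W.bMinus (ν k) (ξ l)) • (W.creations ξ w ν * zeroAt l) := by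
  induction M with
  | zero => simp [creations_zero]
  | succ M ih =>
    have h1 : W.mono ξ (ν 0) (w ++ [l]) 1 0 * zeroAt l =
        W.bMinus (ν 0) (ξ l) • (zeroAt l * W.mono ξ (ν 0) w 1 0) := by
      have c0 := (siteOp_commute_mono (W := W) (ξ := ξ)
        (Matrix.of fun s t => W.R (ν 0) (ξ l) (1, s) (0, t)) (ν 0) hl 0 0).eq
      have c1 := (siteOp_commute_mono (W := W) (ξ := ξ)
        (Matrix.of fun s t => W.R (ν 0) (ξ l) (1, s) (1, t)) (ν 0) hl 1 0).eq
      have c2 := (siteOp_commute_mono (W := W) (ξ := ξ) (Matrix.single 0 0 1) (ν 0) hl 1 0).eq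
      change W.Lop ξ (ν 0) l 1 0 * _ = _ * W.Lop ξ (ν 0) l 1 0 at c0
      change W.Lop ξ (ν 0) l 1 1 * _ = _ * W.Lop ξ (ν 0) l 1 1 at c1
      change zeroAt l * _ = _ * zeroAt l at c2
      rw [mono_concat_apply, c0, c1, add_mul, mul_assoc, mul_assoc, Lop_one_zero_mul_zeroAt,
        Lop_one_one_mul_zeroAt, mul_zero, zero_add, mul_smul_comm, c2]
    have c2 := (siteOp_commute_mono (W := W) (ξ := ξ) (Matrix.single 0 0 1) (ν 0) hl 1 0).eq
    change zeroAt l * _ = _ * zeroAt l at c2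
    rw [creations_succ, mul_assoc, h1, mul_smul_comm, ← mul_assoc, ih, creations_succ,
      Fin.prod_univ_succ, mul_assoc _ _ (zeroAt l), ← c2, smul_mul_assoc, smul_smul, mul_assoc]

/-- A family of row vectors, indexed by the orderings of the sites, which is compatible with the
exchange of two neighbouring sites. -/
def IsCovariant (W : SixVertexWeights Λ) (ξ : ι → Λ) (φ : List ι → (ι → Fin 2) → ℂ) : Prop :=
  ∀ (p : List ι) (i j : ι) (q : List ι), (p ++ i :: j :: q).Nodup →
    φ (p ++ i :: j :: q) ᵥ* W.Rop ξ j i = φ (p ++ j :: i :: q)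

theorem IsCovariant.move {φ : List ι → (ι → Fin 2) → ℂ} (hφ : IsCovariant W ξ φ)
    {p w z : List ι} {l : ι} (h : (p ++ l :: w ++ z).Nodup) :
    φ (p ++ l :: w ++ z) ᵥ* W.Xop ξ l w = φ (p ++ w ++ l :: z) := by
  induction w generalizing p with
  | nil => simp [Xop]
  | cons q w ih =>
    have h1 := hφ p l q (w ++ z) (by simpa using h)
    have h2 := ih (p := p ++ [q]) (by
      refine h.perm ?_
      simp only [List.append_assoc, List.cons_append, List.nil_append]
      exact List.Perm.append_left _ (List.Perm.swap _ _ _))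
    simp only [Xop, List.append_assoc, List.cons_append, List.nil_append] at h1 h2 ⊢
    rw [← vecMul_vecMul, h1, h2]

/-- The value of a covariant family on a state that vanishes on a block of sites does not depend on
the order of this block. -/
theorem IsCovariant.dotProduct_ket_perm {φ : List ι → (ι → Fin 2) → ℂ} (hφ : IsCovariant W ξ φ)
    {z z' : List ι} (hz : z.Perm z') {p : List ι} (h : (p ++ z).Nodup) {s : ι → Fin 2}
    (hs : ∀ i ∈ z, s i = 0) : φ (p ++ z) ⬝ᵥ ket s = φ (p ++ z') ⬝ᵥ ket s := by
  induction hz generalizing p with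
  | nil => rfl
  | cons x _ ih =>
    have := ih (p := p ++ [x]) (by simpa using h) fun i hi => hs i (List.mem_cons_of_mem x hi)
    simpa using this
  | swap x y l =>
    have hyx : x ≠ y := by rintro rfl; simp [List.nodup_append] at h
    rw [← hφ p y x l h, ← dotProduct_mulVec, Rop_ket_zero hyx (hs x (by simp)) (hs y (by simp))]
  | trans h1 _ ih1 ih2 =>
    rw [ih1 h hs, ih2 (h.perm (List.Perm.append_left p h1)) fun i hi => hs i (h1.mem_iff.2 hi)]

/-- The state which is `1` exactly at the sites of `P`. -/
def indicatorState (P : Finset ι) : ι → Fin 2 := fun i => if i ∈ P then 1 else 0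

omit [Fintype ι] in
theorem update_indicatorState (P : Finset ι) (l : ι) :
    update (indicatorState P) l 0 = indicatorState (P.erase l) := by
  funext i
  rcases eq_or_ne i l with rfl | h
  · simp [indicatorState]
  · simp [indicatorState, h]

end Creations

/-! ### Iterating the expansion over all C operators. -/

section Expansion

variable {Λ ι : Type*} [LinearOrder ι]

/-- The weight of the term indexed by `f` in the sum over permutations for a domain wall partition
function of type `C`. -/
noncomputable def pairWeight (W : SixVertexWeights Λ) (ξ : ι → Λ) {M : ℕ} (ν : Fin M → Λ)
    (f : Fin M → ι) : ℂ :=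
  (∏ i, W.cMinus (ν i) (ξ (f i))) * ∏ j, ∏ k ∈ Finset.Ioi j,
    W.siteTheta ξ (f k) (f j) * (W.bMinus (ν k) (ξ (f j)) * W.aMinus (ν j) (ξ (f k))) /
      W.bMinus (ξ (f k)) (ξ (f j))

/-- The weight of the interaction between the sites chosen by `f` and those of `P`. -/
noncomputable def outerWeight (W : SixVertexWeights Λ) (ξ : ι → Λ) {M : ℕ} (ν : Fin M → Λ)
    (f : Fin M → ι) (P : Finset ι) : ℂ :=
  ∏ m, ∏ p ∈ P, W.aMinus (ν m) (ξ p) * W.siteTheta ξ p (f m) / W.bMinus (ξ p) (ξ (f m))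

/-- The product over `S.erase l` in `creationCoeff` splits: sites chosen later by `g` enter
`pairWeight`, sites never chosen enter `outerWeight`. -/
theorem weight_cons (W : SixVertexWeights Λ) (ξ : ι → Λ) {M : ℕ} (ν : Fin (M + 1) → Λ)
    {S : Finset ι} (l : ι) {g : Fin M → ι} (hg : Injective g) (hgS : ∀ i, g i ∈ S.erase l) :
    W.pairWeight ξ ν (Fin.cons l g) * W.outerWeight ξ ν (Fin.cons l g)
        (S \ Finset.univ.image (Fin.cons l g : Fin (M + 1) → ι)) =
      W.creationCoeff ξ (ν 0) S l * (∏ k : Fin M, W.bMinus (ν k.succ) (ξ l)) *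
        (W.pairWeight ξ (fun m => ν m.succ) g *
          W.outerWeight ξ (fun m => ν m.succ) g (S.erase l \ Finset.univ.image g)) := by
  have himg : S \ Finset.univ.image (Fin.cons l g : Fin (M + 1) → ι) =
      S.erase l \ Finset.univ.image g := by
    ext x
    simp only [Finset.mem_sdiff, Finset.mem_image, Finset.mem_univ, true_and, Fin.exists_fin_succ,
      Fin.cons_zero, Fin.cons_succ, Finset.mem_erase]
    grind
  have hsub : Finset.univ.image g ⊆ S.erase l := by
    intro x hx
    obtain ⟨i, -, rfl⟩ := Finset.mem_image.1 hx
    exact hgS i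
  rw [himg, creationCoeff, ← Finset.prod_sdiff hsub, Finset.prod_image fun a _ b _ h => hg h]
  simp only [pairWeight, outerWeight, Fin.prod_univ_succ, Fin.prod_Ioi_zero, Fin.prod_Ioi_succ,
    Fin.cons_zero, Fin.cons_succ]
  have e : ∏ k : Fin M, W.siteTheta ξ (g k) l * (W.bMinus (ν k.succ) (ξ l) *
      W.aMinus (ν 0) (ξ (g k))) / W.bMinus (ξ (g k)) (ξ l) =
      (∏ k : Fin M, W.bMinus (ν k.succ) (ξ l)) *
        ∏ k : Fin M, W.aMinus (ν 0) (ξ (g k)) * W.siteTheta ξ (g k) l / W.bMinus (ξ (g k)) (ξ l) := by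
    rw [← Finset.prod_mul_distrib]
    exact Finset.prod_congr rfl fun k _ => by ring
  rw [e]
  ring

variable [Fintype ι] {W : SixVertexWeights Λ} {ξ : ι → Λ}

theorem YangBaxter.creations_mul_Xop (hYB : W.YangBaxter) {S : Finset ι} {l : ι} (hl : l ∈ S)
    {M : ℕ} (ν : Fin M → Λ) :
    W.creations ξ S.sort ν * W.Xop ξ l (S.filter (l < ·)).sort =
      W.Xop ξ l (S.filter (l < ·)).sort * W.creations ξ ((S.erase l).sort ++ [l]) ν := by
  induction M with
  | zero => simp [creations_zero]
  | succ M ih =>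
    rw [creations_succ, mul_assoc, hYB.mono_mul_Xop _ hl, ← mul_assoc, ih, mul_assoc,
      ← creations_succ]

/-- The `Xop` of each excitation commutes past the remaining C operators, at the price of moving `l`
last, and is absorbed into `φ` by covariance. The list `z` holds the sites already set to 0. -/
theorem YangBaxter.dotProduct_creations_succ (hYB : W.YangBaxter) (hU : W.IsUnitary)
    (hξ : ∀ i j : ι, i ≠ j → W.bMinus (ξ i) (ξ j) ≠ 0) {φ : List ι → (ι → Fin 2) → ℂ}
    (hφ : IsCovariant W ξ φ) {S : Finset ι} {z : List ι} (hz : (S.sort ++ z).Nodup) {M : ℕ}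
    (ν : Fin (M + 1) → Λ) :
    φ (S.sort ++ z) ⬝ᵥ W.creations ξ S.sort ν *ᵥ ket (indicatorState S) =
      ∑ l ∈ S, (W.creationCoeff ξ (ν 0) S l * ∏ k : Fin M, W.bMinus (ν k.succ) (ξ l)) *
        (φ ((S.erase l).sort ++ l :: z) ⬝ᵥ
          W.creations ξ (S.erase l).sort (fun m => ν m.succ) *ᵥ
            ket (indicatorState (S.erase l))) := by
  rw [creations_succ, ← mulVec_mulVec, hYB.mono_one_zero_ket hU hξ (ν 0) S
    fun i hi => by simp [indicatorState, hi], mulVec_sum, dotProduct_sum]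
  refine Finset.sum_congr rfl fun l hl => ?_
  have hmove := hφ.move (p := (S.filter (· < l)).sort) (w := (S.filter (l < ·)).sort) (z := z)
    (l := l) (by rw [← Finset.sort_eq_append hl]; exact hz)
  rw [← Finset.sort_eq_append hl, ← Finset.sort_erase_eq_append] at hmove
  have hzero : zeroAt l *ᵥ ket (indicatorState (S.erase l)) = ket (indicatorState (S.erase l)) :=
    zeroAt_ket (by simp [indicatorState])
  rw [mulVec_smul, dotProduct_smul, excitation, update_indicatorState, mulVec_mulVec,
    hYB.creations_mul_Xop hl, ← mulVec_mulVec, dotProduct_mulVec, hmove, smul_eq_mul, mul_assoc]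
  congr 1
  rw [← hzero, mulVec_mulVec, creations_concat_mul_zeroAt (by simp), smul_mulVec, dotProduct_smul,
    ← mulVec_mulVec, hzero, smul_eq_mul]

/-- Each newly chosen site is placed in front of the earlier ones, hence the reversed list. -/
theorem YangBaxter.dotProduct_creations (hYB : W.YangBaxter) (hU : W.IsUnitary)
    (hξ : ∀ i j : ι, i ≠ j → W.bMinus (ξ i) (ξ j) ≠ 0) {φ : List ι → (ι → Fin 2) → ℂ}
    (hφ : IsCovariant W ξ φ) {S : Finset ι} {z : List ι} (hz : (S.sort ++ z).Nodup) {M : ℕ}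
    (ν : Fin M → Λ) :
    φ (S.sort ++ z) ⬝ᵥ W.creations ξ S.sort ν *ᵥ ket (indicatorState S) =
      ∑ f : Fin M → ι, if Injective f ∧ ∀ i, f i ∈ S then
        W.pairWeight ξ ν f * W.outerWeight ξ ν f (S \ Finset.univ.image f) *
          (φ ((S \ Finset.univ.image f).sort ++ ((List.ofFn f).reverse ++ z)) ⬝ᵥ
            ket (indicatorState (S \ Finset.univ.image f))) else 0 := by
  induction M generalizing S z with
  | zero =>
    have hinj : ∀ f : Fin 0 → ι, Injective f := fun f => injective_of_subsingleton f
    simp [creations_zero, pairWeight, outerWeight, hinj]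
  | succ M ih =>
    rw [hYB.dotProduct_creations_succ hU hξ hφ hz, ← (Fin.consEquiv fun _ => ι).sum_comp,
      Fintype.sum_prod_type, ← Finset.sum_subset (Finset.subset_univ S)]
    · refine Finset.sum_congr rfl fun l hl => ?_
      have hz' : ((S.erase l).sort ++ l :: z).Nodup := by
        have h := hz
        rw [Finset.sort_eq_append hl, List.append_assoc] at h
        rw [Finset.sort_erase_eq_append, List.append_assoc]
        refine h.perm (List.Perm.append_left _ ?_)
        exact List.perm_middle.symm
      rw [ih hz', Finset.mul_sum]
      refine Finset.sum_congr rfl fun g _ => ?_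
      have himg : S \ Finset.univ.image (Fin.cons l g : Fin (M + 1) → ι) =
          S.erase l \ Finset.univ.image g := by
        ext x
        simp only [Finset.mem_sdiff, Finset.mem_image, Finset.mem_univ, true_and,
          Fin.exists_fin_succ, Fin.cons_zero, Fin.cons_succ, Finset.mem_erase]
        grind
      have hcond : (Injective (Fin.cons l g : Fin (M + 1) → ι) ∧
          ∀ i, (Fin.cons l g : Fin (M + 1) → ι) i ∈ S) ↔
          Injective g ∧ ∀ i, g i ∈ S.erase l := by
        simp only [Fin.cons_injective_iff, Fin.forall_fin_succ, Fin.cons_zero, Fin.cons_succ,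
          Finset.mem_erase, Set.mem_range]
        grind
      have hcons : (Fin.consEquiv fun _ => ι) (l, g) = Fin.cons l g := rfl
      rw [hcons]
      by_cases hg : Injective g ∧ ∀ i, g i ∈ S.erase l
      · rw [if_pos hg, if_pos (hcond.2 hg), weight_cons W ξ ν l hg.1 hg.2, himg, mul_assoc]
        simp [List.ofFn_succ, mul_assoc]
      · rw [if_neg hg, if_neg (hcond.not.2 hg), mul_zero]
    · intro l _ hl
      refine Finset.sum_eq_zero fun g _ => if_neg ?_
      rintro ⟨-, h⟩
      exact hl (h 0)

end Expansion

end SixVertexWeights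

theorem matrix_ext_ket {ι m : Type*} [Fintype ι] [DecidableEq ι] {X Y : Matrix m (ι → Fin 2) ℂ}
    (h : ∀ s, X *ᵥ ket s = Y *ᵥ ket s) : X = Y :=
  Matrix.ext_of_mulVec_single h

theorem Function.Injective.extend_update {ι κ : Type*} [DecidableEq ι] [DecidableEq κ] {f : κ → ι}
    (hf : Injective f) (t : κ → Fin 2) (i : κ) (a : Fin 2) :
    extend f (update t i a) (1 : ι → Fin 2) = update (extend f t 1) (f i) a := by
  funext x
  by_cases hx : ∃ k, f k = x
  · obtain ⟨k, rfl⟩ := hx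
    rw [hf.extend_apply]
    rcases eq_or_ne k i with rfl | hk
    · simp
    · rw [update_of_ne hk, update_of_ne (hf.ne hk), hf.extend_apply]
  · rw [extend_apply' _ _ _ hx, update_of_ne (by rintro rfl; exact hx ⟨i, rfl⟩),
      extend_apply' _ _ _ hx]

theorem state0_eq_ket (L : ℕ) : state0 L = ket fun _ => 0 := by
  funext s
  simp only [state0, ket, Pi.single_apply]
  split_ifs with h
  · simp [h]
  · obtain ⟨i, hi⟩ := Function.ne_iff.1 h
    refine Finset.prod_eq_zero (Finset.mem_univ i) ?_
    rw [Fin.eq_one_of_ne_zero _ hi]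
    rfl

theorem state1_eq_ket (L : ℕ) : state1 L = ket fun _ => 1 := by
  funext s
  simp only [state1, ket, Pi.single_apply]
  split_ifs with h
  · simp [h]
  · obtain ⟨i, hi⟩ := Function.ne_iff.1 h
    refine Finset.prod_eq_zero (Finset.mem_univ i) ?_
    have h0 : s i = 0 := by
      by_contra h'
      exact hi (Fin.eq_one_of_ne_zero _ h')
    rw [h0]
    rfl

namespace SixVertexWeights

/-! ### Identification with the operators B and C of the statement. -/

section Components

variable {Λ : Type*} {W : SixVertexWeights Λ} {L : ℕ} {ξ : Fin L → Λ}

/-- The entries, in the auxiliary space, of an operator on the auxiliary space and `L` sites. -/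
def auxEntries (X : Matrix (Fin (L + 1) → Fin 2) (Fin (L + 1) → Fin 2) ℂ) :
    Matrix (Fin 2) (Fin 2) (Matrix (Fin L → Fin 2) (Fin L → Fin 2) ℂ) :=
  fun a b s t => X (Fin.cons a s) (Fin.cons b t)

theorem auxEntries_one :
    auxEntries (1 : Matrix (Fin (L + 1) → Fin 2) (Fin (L + 1) → Fin 2) ℂ) = 1 := by
  funext a b s t
  by_cases h : a = b
  · subst h
    simp [auxEntries, Matrix.one_apply]
  · simp [auxEntries, h]

theorem auxEntries_mul (X Y : Matrix (Fin (L + 1) → Fin 2) (Fin (L + 1) → Fin 2) ℂ) :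
    auxEntries (X * Y) = auxEntries X * auxEntries Y := by
  funext a b s t
  simp only [auxEntries, Matrix.mul_apply, Matrix.sum_apply]
  rw [← (Fin.consEquiv fun _ => Fin 2).sum_comp, Fintype.sum_prod_type]
  rfl

theorem auxEntries_actOnPair (u : Λ) (i : Fin L) :
    auxEntries (actOnPair (W.R u (ξ i)) (0 : Fin (L + 1)) i.succ) = W.Lop ξ u i := by
  funext a b s t
  simp [auxEntries, actOnPair, Lop, siteOp, Fin.forall_fin_succ]

theorem auxEntries_monodromy (u : Λ) :
    auxEntries (W.monodromy ξ u) = W.mono ξ u (List.finRange L) := by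
  rw [monodromy, List.ofFn_eq_map]
  generalize List.finRange L = w
  induction w with
  | nil => simp [auxEntries_one, mono_nil]
  | cons i w ih =>
    rw [List.map_cons, List.reverse_cons, List.prod_append, auxEntries_mul, ih, List.prod_singleton,
      auxEntries_actOnPair, mono_cons]

theorem opB_eq_mono (u : Λ) : W.opB ξ u = W.mono ξ u (List.finRange L) 0 1 := by
  rw [← auxEntries_monodromy]
  rfl

theorem opC_eq_mono (u : Λ) : W.opC ξ u = W.mono ξ u (List.finRange L) 1 0 := by
  rw [← auxEntries_monodromy]
  rfl

theorem prodC_eq_creations {M : ℕ} (ν : Fin M → Λ) :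
    W.prodC ξ ν = W.creations ξ (List.finRange L) ν := by
  simp only [prodC, creations, opC_eq_mono]

end Components

/-! ### Symmetry under transposition, which exchanges c₊ and c₋. -/

section Transpose

/-- The weights of the transposed `R`-matrix. -/
def transpose {Λ : Type*} (W : SixVertexWeights Λ) : SixVertexWeights Λ :=
  { W with cPlus := W.cMinus, cMinus := W.cPlus }

theorem R_transpose {Λ : Type*} (W : SixVertexWeights Λ) (u v : Λ) :
    W.transpose.R u v = (W.R u v)ᵀ := by
  ext ⟨a, b⟩ ⟨c, d⟩
  rw [Matrix.transpose_apply]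
  fin_cases a <;> fin_cases c <;>
    simp only [Fin.zero_eta, Fin.mk_one, R_zero_left, R_one_left, R_zero_one, R_one_zero] <;>
    fin_cases b <;> fin_cases d <;> rfl

theorem _root_.actOnPair_transpose {ι : Type*} [Fintype ι] [DecidableEq ι]
    (X : Matrix (Fin 2 × Fin 2) (Fin 2 × Fin 2) ℂ) (i j : ι) :
    (actOnPair X i j)ᵀ = actOnPair Xᵀ i j := by
  ext s t
  simp [actOnPair, eq_comm]

variable {Λ : Type*} {W : SixVertexWeights Λ}

theorem IsUnitary.transpose (hU : W.IsUnitary) : W.transpose.IsUnitary := by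
  intro u v
  have h := congrArg Matrix.transpose (hU u v)
  rw [transpose_mul, actOnPair_transpose, actOnPair_transpose, ← R_transpose, ← R_transpose,
    transpose_one] at h
  exact mul_eq_one_comm.1 h

theorem YangBaxter.transpose (hYB : W.YangBaxter) : W.transpose.YangBaxter := by
  intro u v w
  have h := congrArg Matrix.transpose (hYB u v w)
  simp only [transpose_mul, actOnPair_transpose, ← R_transpose] at h
  rw [mul_assoc, mul_assoc, h]

theorem IsUnitary.aMinus_mul_aMinus (hU : W.IsUnitary) (u v : Λ) :
    W.aMinus u v * W.aMinus v u = 1 := by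
  have h := congrFun (congrArg (· *ᵥ ket (ι := Fin 2) fun _ => 1) (hU u v)) fun _ => 1
  have h1 := Rop_ket_one (W := W) (ξ := ![u, v]) (show (0 : Fin 2) ≠ 1 by decide)
    (s := fun _ => 1) rfl rfl
  have h2 := Rop_ket_one (W := W) (ξ := ![u, v]) (show (1 : Fin 2) ≠ 0 by decide)
    (s := fun _ => 1) rfl rfl
  simp only [Rop, Matrix.cons_val_zero, Matrix.cons_val_one] at h1 h2
  simp only [← mulVec_mulVec, h2, mulVec_smul, h1, one_mulVec] at h
  rw [mul_comm]
  simpa [ket] using h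

variable {ι : Type*} [Fintype ι] [DecidableEq ι] {ξ : ι → Λ}

theorem Rop_transpose (i j : ι) : W.transpose.Rop ξ i j = (W.Rop ξ i j)ᵀ := by
  rw [Rop, Rop, actOnPair_transpose, R_transpose]

theorem Lop_transpose (u : Λ) (i : ι) (a b : Fin 2) :
    W.transpose.Lop ξ u i a b = (W.Lop ξ u i b a)ᵀ := by
  rw [Lop, Lop, siteOp_transpose]
  congr 1
  ext s t
  simp [R_transpose]

theorem mono_transpose (u : Λ) (w : List ι) (a b : Fin 2) :
    W.transpose.mono ξ u w.reverse a b = (W.mono ξ u w b a)ᵀ := by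
  induction w generalizing a with
  | nil =>
    rw [List.reverse_nil, mono_nil, mono_nil]
    fin_cases a <;> fin_cases b <;> simp
  | cons i w ih =>
    rw [List.reverse_cons, mono_concat_apply, ih, ih, mono_cons_apply, Lop_transpose,
      Lop_transpose, transpose_add, transpose_mul, transpose_mul]

theorem ket_vecMul_Rop_one {i j : ι} (hij : i ≠ j) {s : ι → Fin 2} (hi : s i = 1) (hj : s j = 1) :
    ket s ᵥ* W.Rop ξ i j = W.aMinus (ξ i) (ξ j) • ket s := by
  rw [← mulVec_transpose, ← Rop_transpose, Rop_ket_one hij hi hj]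
  rfl

theorem ket_vecMul_Rop_zero {i j : ι} (hij : i ≠ j) {s : ι → Fin 2} (hi : s i = 0)
    (hj : s j = 0) : ket s ᵥ* W.Rop ξ i j = ket s := by
  rw [← mulVec_transpose, ← Rop_transpose, Rop_ket_zero hij hi hj]

end Transpose

/-! ### Restriction to a subset of the sites. -/

section Embedding

variable {Λ ι κ : Type*} [Fintype ι] [DecidableEq ι] [Fintype κ] [DecidableEq κ]
  {W : SixVertexWeights Λ} {ξ : ι → Λ} {f : κ → ι}

/-- The inclusion of the states of the sites `κ` into those of the sites `ι`, with a `1` at all the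
sites outside the range of `f`. -/
noncomputable def inclusion (f : κ → ι) : Matrix (ι → Fin 2) (κ → Fin 2) ℂ :=
  fun x t => if x = extend f t 1 then 1 else 0

omit [DecidableEq ι] in
theorem inclusion_mulVec_ket (t : κ → Fin 2) : inclusion f *ᵥ ket t = ket (extend f t 1) := by
  funext x
  simp [inclusion, ket, Pi.single_apply]

omit [DecidableEq κ] in
theorem ket_vecMul_inclusion (hf : Injective f) {s : ι → Fin 2} {t : κ → Fin 2}
    (h : s = extend f t 1) : ket s ᵥ* inclusion f = ket t := by
  funext r
  simp only [ket, single_one_vecMul, Matrix.row, inclusion, h, Pi.single_apply]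
  congr 1
  refine propext ⟨fun h => funext fun k => ?_, fun h => by rw [h]⟩
  have hk := congrFun h (f k)
  rwa [hf.extend_apply, hf.extend_apply, eq_comm] at hk

theorem siteOp_mul_inclusion (hf : Injective f) (i : κ) (A : Matrix (Fin 2) (Fin 2) ℂ) :
    siteOp (f i) A * inclusion f = inclusion f * siteOp i A := by
  refine matrix_ext_ket fun s => ?_
  rw [← mulVec_mulVec, ← mulVec_mulVec, inclusion_mulVec_ket, siteOp_mulVec_ket,
    siteOp_mulVec_ket, mulVec_sum]
  refine Finset.sum_congr rfl fun a _ => ?_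
  rw [mulVec_smul, inclusion_mulVec_ket, hf.extend_update, hf.extend_apply]

theorem mono_map_mul_inclusion (hf : Injective f) (u : Λ) (w : List κ) (a b : Fin 2) :
    W.mono ξ u (w.map f) a b * inclusion f = inclusion f * W.mono (ξ ∘ f) u w a b := by
  induction w generalizing b with
  | nil =>
    rw [List.map_nil, mono_nil, mono_nil, Matrix.one_apply, Matrix.one_apply]
    split_ifs <;> simp
  | cons i w ih =>
    have h : ∀ c, W.Lop ξ u (f i) c b * inclusion f = inclusion f * W.Lop (ξ ∘ f) u i c b :=
      fun c => siteOp_mul_inclusion hf i _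
    rw [List.map_cons, mono_cons_apply, mono_cons_apply, Matrix.add_mul, Matrix.mul_assoc,
      Matrix.mul_assoc, h, h, ← Matrix.mul_assoc, ← Matrix.mul_assoc, ih, ih, Matrix.mul_add,
      Matrix.mul_assoc, Matrix.mul_assoc]

theorem list_prod_mul_inclusion {n : ℕ} {F : Fin n → Matrix (ι → Fin 2) (ι → Fin 2) ℂ}
    {G : Fin n → Matrix (κ → Fin 2) (κ → Fin 2) ℂ}
    (h : ∀ m, F m * inclusion f = inclusion f * G m) (w : List (Fin n)) :
    (w.map F).prod * inclusion f = inclusion f * (w.map G).prod := by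
  induction w with
  | nil => simp
  | cons m w ih =>
    rw [List.map_cons, List.map_cons, List.prod_cons, List.prod_cons, Matrix.mul_assoc, ih,
      ← Matrix.mul_assoc, h, Matrix.mul_assoc]

theorem creations_map_mul_inclusion (hf : Injective f) (w : List κ) {M : ℕ} (ν : Fin M → Λ) :
    W.creations ξ (w.map f) ν * inclusion f = inclusion f * W.creations (ξ ∘ f) w ν := by
  rw [creations, creations, List.ofFn_eq_map, List.ofFn_eq_map, ← List.map_reverse,
    ← List.map_reverse]
  exact list_prod_mul_inclusion (fun m => mono_map_mul_inclusion hf _ _ _ _) _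

end Embedding

/-! ### Domain wall partition functions as sums over permutations. -/

section DomainWall

variable {Λ : Type*} {W : SixVertexWeights Λ} {M : ℕ} {η : Fin M → Λ}

theorem isCovariant_ket_zero (W : SixVertexWeights Λ) {ι : Type*} [Fintype ι] [DecidableEq ι]
    (ξ : ι → Λ) : IsCovariant W ξ fun _ => ket fun _ => 0 := by
  intro p i j q h
  have hij : j ≠ i := by rintro rfl; simp [List.nodup_append] at h
  exact ket_vecMul_Rop_zero hij rfl rfl

/-- ⟨0| is fixed by every R-matrix, so the constant family is covariant. With as many C operators as
sites, the injective choices are the permutations and no site is left over. -/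
theorem dwpfC_eq_sum (hYB : W.YangBaxter) (hU : W.IsUnitary)
    (hη : ∀ i j : Fin M, i ≠ j → W.bMinus (η i) (η j) ≠ 0) (ν : Fin M → Λ) :
    W.dwpfC ν η = ∑ σ : Equiv.Perm (Fin M), W.pairWeight η ν σ := by
  have h := hYB.dotProduct_creations hU hη (isCovariant_ket_zero W η) (S := Finset.univ)
    (z := []) (by simp) ν
  have hone : indicatorState (Finset.univ : Finset (Fin M)) = fun _ => 1 := by
    funext i; simp [indicatorState]
  rw [hone, Fin.sort_univ] at h
  rw [dwpfC, prodC_eq_creations, state0_eq_ket, state1_eq_ket, h]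
  symm
  refine Fintype.sum_of_injective (fun σ : Equiv.Perm (Fin M) => (σ : Fin M → Fin M))
    DFunLike.coe_injective _ _ ?_ ?_
  · intro f hf
    refine if_neg fun hinj => hf ⟨Equiv.ofBijective f (Finite.injective_iff_bijective.1 hinj.1), ?_⟩
    rfl
  · intro σ
    have himg : Finset.univ.image σ = Finset.univ :=
      Finset.image_univ_of_surjective σ.surjective
    have hzero : indicatorState (∅ : Finset (Fin M)) = fun _ => 0 := by
      funext i; simp [indicatorState]
    rw [if_pos ⟨σ.injective, fun _ => Finset.mem_univ _⟩, himg, sdiff_self]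
    simp [outerWeight, hzero, ket]

/-- Transposition turns B into C but also reverses the order of the sites; relabelling along
`Fin.rev` restores it. -/
theorem dwpfB_eq_dwpfC_transpose (μ : Fin M → Λ) :
    W.dwpfB μ η = W.transpose.dwpfC μ (η ∘ Fin.rev) := by
  have h1 : (W.prodB η μ)ᵀ = W.transpose.creations η (List.finRange M).reverse μ := by
    rw [prodB, creations, transpose_list_prod, List.map_ofFn]
    congr 3
    funext m
    rw [mono_transpose, Function.comp_apply, opB_eq_mono]
  have h2 := creations_map_mul_inclusion (W := W.transpose) (ξ := η) Fin.rev_injective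
    (List.finRange M) μ
  have e1 : (fun _ => 1 : Fin M → Fin 2) = extend Fin.rev (fun _ : Fin M => 1) 1 := by
    funext i
    rw [← Fin.rev_rev i, Fin.rev_injective.extend_apply]
  have e0 : (fun _ => 0 : Fin M → Fin 2) = extend Fin.rev (fun _ : Fin M => 0) 1 := by
    funext i
    rw [← Fin.rev_rev i, Fin.rev_injective.extend_apply]
  rw [dwpfB, dwpfC, prodC_eq_creations, state0_eq_ket, state1_eq_ket, dotProduct_mulVec,
    dotProduct_comm, ← mulVec_transpose, h1, List.finRange_reverse]
  conv_lhs => rw [e1, ← inclusion_mulVec_ket, mulVec_mulVec, h2, ← mulVec_mulVec,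
    dotProduct_mulVec, ket_vecMul_inclusion Fin.rev_injective e0]

theorem dwpfB_eq_sum (hYB : W.YangBaxter) (hU : W.IsUnitary)
    (hη : ∀ i j : Fin M, i ≠ j → W.bMinus (η i) (η j) ≠ 0) (μ : Fin M → Λ) :
    W.dwpfB μ η = ∑ τ : Equiv.Perm (Fin M), (∏ i, W.cPlus (μ i) (η (τ i))) *
      ∏ j, ∏ k ∈ Finset.Ioi j, (W.bMinus (μ k) (η (τ j)) * W.aMinus (μ j) (η (τ k))) /
        (W.siteTheta η (τ j) (τ k) * W.bMinus (η (τ k)) (η (τ j))) := by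
  rw [dwpfB_eq_dwpfC_transpose, dwpfC_eq_sum (η := η ∘ Fin.rev)
    hYB.transpose hU.transpose fun i j hij => hη _ _ (Fin.rev_injective.ne hij), ← Equiv.sum_comp (Equiv.mulLeft (Fin.revPerm (n := M)))]
  refine Finset.sum_congr rfl fun τ _ => ?_
  have e : ∀ i, (η ∘ Fin.rev) ((Equiv.mulLeft Fin.revPerm τ) i) = η (τ i) := fun i => by simp
  simp only [pairWeight, e]
  congr 1
  refine Finset.prod_congr rfl fun j _ => Finset.prod_congr rfl fun k hk => ?_
  have hjk : τ j ≠ τ k := τ.injective.ne (Finset.mem_Ioi.1 hk).ne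
  have ha := hU.aMinus_mul_aMinus (η (τ j)) (η (τ k))
  -- Reversing the sites reverses the inequality in θ, and unitarity turns a₋(η_k, η_j) into
  -- 1/a₋(η_j, η_k); hence θ moves to the denominator for type B.
  have hθ : W.transpose.siteTheta (η ∘ Fin.rev) ((Equiv.mulLeft Fin.revPerm τ) k)
      ((Equiv.mulLeft Fin.revPerm τ) j) = (W.siteTheta η (τ j) (τ k))⁻¹ := by
    simp only [siteTheta, e]
    rcases lt_or_gt_of_ne hjk with h | h
    · simp only [Equiv.coe_mulLeft, Equiv.Perm.mul_apply, Fin.revPerm_apply, Fin.rev_lt_rev, h, if_true]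
      exact eq_inv_of_mul_eq_one_right ha
    · simp [Fin.rev_lt_rev, h.not_gt]
  rw [hθ]
  change (W.siteTheta η (τ j) (τ k))⁻¹ * (W.bMinus (μ k) (η (τ j)) * W.aMinus (μ j) (η (τ k))) /
    W.bMinus (η (τ k)) (η (τ j)) = _
  rw [div_mul_eq_div_div, inv_mul_eq_div]

end DomainWall

end SixVertexWeights

/-- An injective map factors uniquely as an increasing map after a permutation, the latter obtained
by sorting. -/
theorem Fin.sum_injective_eq_sum_orderEmb_perm {ι : Type*} [LinearOrder ι] [Fintype ι] {M : ℕ}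
    (F : (Fin M → ι) → ℂ) :
    ∑ f : Fin M → ι, (if Injective f then F f else 0) =
      ∑ l : Fin M ↪o ι, ∑ σ : Equiv.Perm (Fin M), F (l ∘ σ) := by
  rw [← Fintype.sum_prod_type']
  symm
  refine Fintype.sum_of_injective
    (fun x : (Fin M ↪o ι) × Equiv.Perm (Fin M) => (x.1 ∘ x.2 : Fin M → ι)) ?_ _ _ ?_ ?_
  · rintro ⟨l, σ⟩ ⟨l', σ'⟩ h
    have hrange : Set.range l = Set.range l' := by
      have h' := congrArg Set.range h
      simpa only [EquivLike.range_comp] using h'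
    have hl : l = l' := by
      ext i
      exact congrFun ((StrictMono.range_inj l.strictMono l'.strictMono).1 hrange) i
    subst hl
    have hσ : σ = σ' := Equiv.ext fun i => l.injective (congrFun h i)
    rw [hσ]
  · intro f hf
    refine if_neg fun hinj => hf ?_
    have hmono : StrictMono (f ∘ Tuple.sort f) :=
      (Tuple.monotone_sort f).strictMono_of_injective (hinj.comp (Tuple.sort f).injective)
    refine ⟨(OrderEmbedding.ofStrictMono _ hmono, (Tuple.sort f)⁻¹), ?_⟩
    funext i
    simp
  · rintro ⟨l, σ⟩
    rw [if_pos (l.injective.comp σ.injective)]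

namespace SixVertexWeights

/-! ### Products of B operators. -/

section Annihilations

variable {Λ ι : Type*} [Fintype ι] [DecidableEq ι] {W : SixVertexWeights Λ} {ξ : ι → Λ}

variable (W ξ) in
/-- The product `B(μ_1) ⋯ B(μ_M)` over the sites of a list. -/
noncomputable def annihilations (w : List ι) {M : ℕ} (μ : Fin M → Λ) :
    Matrix (ι → Fin 2) (ι → Fin 2) ℂ :=
  (List.ofFn fun m => W.mono ξ (μ m) w 0 1).prod

theorem annihilations_zero (w : List ι) (μ : Fin 0 → Λ) : W.annihilations ξ w μ = 1 := by
  simp [annihilations]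

theorem annihilations_succ (w : List ι) {M : ℕ} (μ : Fin (M + 1) → Λ) :
    W.annihilations ξ w μ =
      W.mono ξ (μ 0) w 0 1 * W.annihilations ξ w (fun m => μ m.succ) := by
  simp [annihilations, List.ofFn_succ]

theorem prodB_eq_annihilations {L M : ℕ} (ξ : Fin L → Λ) (μ : Fin M → Λ) :
    W.prodB ξ μ = W.annihilations ξ (List.finRange L) μ := by
  simp only [prodB, annihilations, opB_eq_mono]

theorem YangBaxter.annihilations_swap (hYB : W.YangBaxter) {p q : List ι} {i j : ι}
    (h : (p ++ i :: j :: q).Nodup) {M : ℕ} (μ : Fin M → Λ) :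
    W.annihilations ξ (p ++ i :: j :: q) μ * W.Rop ξ j i =
      W.Rop ξ j i * W.annihilations ξ (p ++ j :: i :: q) μ := by
  induction M with
  | zero => simp [annihilations_zero]
  | succ M ih =>
    rw [annihilations_succ, mul_assoc, ih, ← mul_assoc, hYB.mono_swap _ h, mul_assoc,
      ← annihilations_succ]

theorem mono_commute_mono {p z : List ι} (h : List.Disjoint p z) (u v : Λ) (a b c d : Fin 2) :
    Commute (W.mono ξ u p a b) (W.mono ξ v z c d) :=
  commute_mono (fun _ hj _ _ => (siteOp_commute_mono _ u (fun hi => h hi hj) a b).symm) c d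

theorem mono_commute_annihilations {p z : List ι} (h : List.Disjoint p z) (u : Λ) (a b : Fin 2)
    {M : ℕ} (μ : Fin M → Λ) : Commute (W.mono ξ u p a b) (W.annihilations ξ z μ) := by
  induction M with
  | zero => rw [annihilations_zero]; exact Commute.one_right _
  | succ M ih =>
    rw [annihilations_succ]
    exact (mono_commute_mono h u _ a b 0 1).mul_right (ih _)

/-- Over `p`, B kills the ones and D is scalar on them; both commute with the operators over `z` and
so reach the ket unchanged. -/
theorem annihilations_append_ket {p z : List ι} (h : List.Disjoint p z) {s : ι → Fin 2}
    (hs : ∀ i ∈ p, s i = 1) {M : ℕ} (μ : Fin M → Λ) :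
    W.annihilations ξ (p ++ z) μ *ᵥ ket s =
      (∏ m, (p.map fun i => W.aMinus (μ m) (ξ i)).prod) • W.annihilations ξ z μ *ᵥ ket s := by
  induction M with
  | zero => simp [annihilations_zero]
  | succ M ih =>
    have h0 : W.mono ξ (μ 0) p 0 1 *ᵥ W.annihilations ξ z (fun m => μ m.succ) *ᵥ ket s = 0 := by
      rw [mulVec_mulVec, (mono_commute_annihilations h _ _ _ _).eq, ← mulVec_mulVec,
        mono_zero_one_ket _ hs, mulVec_zero]
    have h1 : W.mono ξ (μ 0) p 1 1 *ᵥ W.annihilations ξ z (fun m => μ m.succ) *ᵥ ket s =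
        (p.map fun i => W.aMinus (μ 0) (ξ i)).prod •
          W.annihilations ξ z (fun m => μ m.succ) *ᵥ ket s := by
      rw [mulVec_mulVec, (mono_commute_annihilations h _ _ _ _).eq, ← mulVec_mulVec,
        mono_one_one_ket _ hs, mulVec_smul]
    rw [annihilations_succ, ← mulVec_mulVec, ih, mulVec_smul, mono_append, Matrix.mul_apply,
      Fin.sum_univ_two, add_mulVec, ← mulVec_mulVec, ← mulVec_mulVec, h0, h1, mulVec_zero, zero_add,
      mulVec_smul, smul_smul, annihilations_succ, ← mulVec_mulVec, Fin.prod_univ_succ, mul_comm]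

theorem annihilations_map_mul_inclusion {κ : Type*} [Fintype κ] [DecidableEq κ] {f : κ → ι}
    (hf : Injective f) (w : List κ) {M : ℕ} (μ : Fin M → Λ) :
    W.annihilations ξ (w.map f) μ * inclusion f =
      inclusion f * W.annihilations (ξ ∘ f) w μ := by
  rw [annihilations, annihilations, List.ofFn_eq_map, List.ofFn_eq_map]
  exact list_prod_mul_inclusion (fun m => mono_map_mul_inclusion hf _ _ _ _) _

end Annihilations

/-! ### Normalizing ⟨1|B⋯B to a covariant family. -/

section Inversions

variable {Λ ι : Type*} [LinearOrder ι]

/-- The factor by which an ordered pair of sites contributes to `inversionWeight`. -/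
noncomputable def inversionFactor (W : SixVertexWeights Λ) (ξ : ι → Λ) (i j : ι) : ℂ :=
  if j < i then W.aMinus (ξ i) (ξ j) else 1

/-- The product of the weights `a₋(ξ_i, ξ_j)` over the inversions of an ordering of the sites. -/
noncomputable def inversionWeight (W : SixVertexWeights Λ) (ξ : ι → Λ) : List ι → ℂ
  | [] => 1
  | i :: w => (w.map (W.inversionFactor ξ i)).prod * inversionWeight W ξ w

variable {W : SixVertexWeights Λ} {ξ : ι → Λ}

theorem inversionWeight_append (p z : List ι) :
    W.inversionWeight ξ (p ++ z) = W.inversionWeight ξ p * W.inversionWeight ξ z *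
      (p.map fun i => (z.map (W.inversionFactor ξ i)).prod).prod := by
  induction p with
  | nil => simp [inversionWeight]
  | cons i p ih =>
    simp only [List.cons_append, inversionWeight, ih, List.map_append, List.prod_append,
      List.map_cons, List.prod_cons]
    ring

theorem inversionWeight_of_pairwise {w : List ι} (hw : w.Pairwise (· ≤ ·)) :
    W.inversionWeight ξ w = 1 := by
  induction w with
  | nil => rfl
  | cons i w ih =>
    rw [List.pairwise_cons] at hw
    rw [inversionWeight, ih hw.2, mul_one]
    refine List.prod_eq_one fun x hx => ?_
    obtain ⟨j, hj, rfl⟩ := List.mem_map.1 hx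
    exact if_neg (hw.1 j hj).not_gt

theorem IsUnitary.inversionFactor_mul (hU : W.IsUnitary) {i j : ι} (hij : i ≠ j) :
    W.inversionFactor ξ i j * W.aMinus (ξ j) (ξ i) = W.inversionFactor ξ j i := by
  rcases lt_or_gt_of_ne hij with h | h
  · simp [inversionFactor, h, h.not_gt]
  · simp [inversionFactor, h, h.not_gt, hU.aMinus_mul_aMinus]

theorem IsUnitary.inversionWeight_swap (hU : W.IsUnitary) (p q : List ι) {i j : ι} (hij : i ≠ j) :
    W.inversionWeight ξ (p ++ i :: j :: q) * W.aMinus (ξ j) (ξ i) =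
      W.inversionWeight ξ (p ++ j :: i :: q) := by
  simp only [inversionWeight_append, inversionWeight, List.map_cons, List.prod_cons,
    ← hU.inversionFactor_mul hij]
  have e : (p.map fun k => W.inversionFactor ξ k i *
      (W.inversionFactor ξ k j * (q.map (W.inversionFactor ξ k)).prod)) =
      p.map fun k => W.inversionFactor ξ k j *
        (W.inversionFactor ξ k i * (q.map (W.inversionFactor ξ k)).prod) :=
    List.map_congr_left fun k _ => by ring
  rw [e]
  ring

theorem inversionFactor_mul_siteTheta {i j : ι} (hij : i ≠ j) :
    W.inversionFactor ξ i j * W.siteTheta ξ i j = W.aMinus (ξ i) (ξ j) := by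
  rcases lt_or_gt_of_ne hij with h | h <;> simp [inversionFactor, siteTheta, h, h.not_gt]

variable [Fintype ι]

/-- The row vectors `⟨1| B(μ_1) ⋯ B(μ_M)`, normalized so that they form a covariant family. -/
noncomputable def braAnnihilations (W : SixVertexWeights Λ) (ξ : ι → Λ) {M : ℕ} (μ : Fin M → Λ)
    (w : List ι) : (ι → Fin 2) → ℂ :=
  W.inversionWeight ξ w • (ket (fun _ => 1) ᵥ* W.annihilations ξ w μ)

/-- Since ⟨1| is a left eigenvector of R with eigenvalue a₋, an exchange of neighbours produces
exactly the factor by which the inversion weight changes. -/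
theorem YangBaxter.isCovariant_braAnnihilations (hYB : W.YangBaxter) (hU : W.IsUnitary) {M : ℕ}
    (μ : Fin M → Λ) : IsCovariant W ξ (W.braAnnihilations ξ μ) := by
  intro p i j q h
  have hij : j ≠ i := by rintro rfl; simp [List.nodup_append] at h
  rw [braAnnihilations, smul_vecMul, vecMul_vecMul, hYB.annihilations_swap h, ← vecMul_vecMul,
    ket_vecMul_Rop_one hij rfl rfl, smul_vecMul, smul_smul, hU.inversionWeight_swap p q hij.symm]
  rfl

/-- The sites of `P` act first and carry 1, so they only contribute scalars. The remaining sites are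
all 0 and run in increasing order, which leaves a domain wall pairing; only inversions between the
two blocks remain. -/
theorem braAnnihilations_dotProduct_ket {M N : ℕ} (μ : Fin M → Λ) (l : Fin N ↪o ι)
    {P : Finset ι} (hP : P = Finset.univ \ Finset.univ.image l) :
    W.braAnnihilations ξ μ (P.sort ++ (List.finRange N).map l) ⬝ᵥ ket (indicatorState P) =
      (∏ m, ∏ p ∈ P, W.inversionFactor ξ p (l m)) * (∏ m, ∏ p ∈ P, W.aMinus (μ m) (ξ p)) *
        (state1 N ⬝ᵥ W.prodB (ξ ∘ l) μ *ᵥ state0 N) := by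
  have hmem : ∀ i, i ∈ P ↔ ¬ ∃ m, l m = i := fun i => by simp [hP]
  have hsorted : ((List.finRange N).map l).Pairwise (· ≤ ·) := by
    rw [List.pairwise_map]
    refine List.Pairwise.imp (fun {a b} (h : a ≤ b) => l.monotone h) ?_
    rw [← Fin.sort_univ]
    exact Finset.pairwise_sort _ _
  have hdisj : List.Disjoint P.sort ((List.finRange N).map l) := by
    intro i hi hi'
    obtain ⟨m, -, rfl⟩ := List.mem_map.1 hi'
    exact (hmem _).1 ((Finset.mem_sort _).1 hi) ⟨m, rfl⟩
  have hket : indicatorState P = extend l (fun _ : Fin N => 0) 1 := by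
    funext i
    by_cases h : ∃ m, l m = i
    · obtain ⟨m, rfl⟩ := h
      rw [l.injective.extend_apply, indicatorState, if_neg fun h => (hmem _).1 h ⟨m, rfl⟩]
    · rw [extend_apply' _ _ _ h, indicatorState, if_pos ((hmem i).2 h)]
      rfl
  have hone : (fun _ => 1 : ι → Fin 2) = extend l (fun _ : Fin N => 1) 1 := by
    funext i
    by_cases h : ∃ m, l m = i
    · obtain ⟨m, rfl⟩ := h
      rw [l.injective.extend_apply]
    · rw [extend_apply' _ _ _ h]
      rfl
  have hinv : W.inversionWeight ξ (P.sort ++ (List.finRange N).map l) =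
      ∏ m, ∏ p ∈ P, W.inversionFactor ξ p (l m) := by
    rw [inversionWeight_append, inversionWeight_of_pairwise (Finset.pairwise_sort _ _),
      inversionWeight_of_pairwise hsorted, Finset.prod_map_sort, one_mul, one_mul,
      Finset.prod_comm]
    refine Finset.prod_congr rfl fun p _ => ?_
    rw [List.map_map, ← List.ofFn_eq_map, List.prod_ofFn]
    rfl
  have hP1 : ∀ i ∈ P.sort, indicatorState P i = 1 := fun i hi =>
    if_pos ((Finset.mem_sort _).1 hi)
  rw [braAnnihilations, smul_dotProduct, ← dotProduct_mulVec, annihilations_append_ket hdisj hP1,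
    dotProduct_smul, hinv, smul_eq_mul, smul_eq_mul,
    hket, ← inclusion_mulVec_ket, mulVec_mulVec, annihilations_map_mul_inclusion l.injective,
    ← mulVec_mulVec, dotProduct_mulVec, ket_vecMul_inclusion l.injective hone,
    prodB_eq_annihilations, state0_eq_ket, state1_eq_ket, mul_assoc]
  simp only [Finset.prod_map_sort]

end Inversions

/-! ### Assembling the scalar product. -/

section ScalarProduct

variable {Λ : Type*} {W : SixVertexWeights Λ} {L M : ℕ} {ξ : Fin L → Λ}

theorem pairWeight_comp (ν : Fin M → Λ) (l : Fin M ↪o Fin L) (σ : Fin M → Fin M) :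
    W.pairWeight ξ ν (l ∘ σ) = W.pairWeight (ξ ∘ l) ν σ := by
  simp [pairWeight, siteTheta]

/-- The θ from the C expansion and the inversion factor from the B family cover complementary orders
of `p` and `l m`, and together give a₋(ξ_p, ξ_{l m}), the inverse of a₋(ξ_{l m}, ξ_p). -/
theorem IsUnitary.subsetWeight_eq (hU : W.IsUnitary) (μ ν : Fin M → Λ) (l : Fin M ↪o Fin L)
    (σ : Equiv.Perm (Fin M)) {P : Finset (Fin L)} (hP : P = (Finset.univ.image l)ᶜ) :
    W.subsetWeight ξ μ ν l = W.outerWeight ξ ν (l ∘ σ) P *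
      ((∏ m, ∏ p ∈ P, W.inversionFactor ξ p (l m)) * ∏ m, ∏ p ∈ P, W.aMinus (μ m) (ξ p)) := by
  have houter : W.outerWeight ξ ν (l ∘ σ) P = (∏ m, ∏ p ∈ P, W.aMinus (ν m) (ξ p)) *
      ∏ m, ∏ p ∈ P, W.siteTheta ξ p (l m) / W.bMinus (ξ p) (ξ (l m)) := by
    rw [← Equiv.prod_comp σ fun m => ∏ p ∈ P, W.siteTheta ξ p (l m) / W.bMinus (ξ p) (ξ (l m))]
    simp only [outerWeight, ← Finset.prod_mul_distrib, mul_div_assoc, Function.comp_apply]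
  rw [houter, subsetWeight, ← hP]
  simp only [← Finset.prod_mul_distrib]
  refine Finset.prod_congr rfl fun m _ => Finset.prod_congr rfl fun p hp => ?_
  have hpl : p ≠ l m := by
    rintro rfl
    rw [hP] at hp
    simp at hp
  have ha : (W.aMinus (ξ (l m)) (ξ p))⁻¹ = W.aMinus (ξ p) (ξ (l m)) :=
    (eq_inv_of_mul_eq_one_right (hU.aMinus_mul_aMinus _ _)).symm
  rw [div_mul_eq_div_div, div_eq_mul_inv _ (W.aMinus (ξ (l m)) (ξ p)), ha,
    ← inversionFactor_mul_siteTheta hpl]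
  ring

theorem YangBaxter.scalarProduct_eq_sum (hYB : W.YangBaxter) (hU : W.IsUnitary)
    (hξ : ∀ i j : Fin L, i ≠ j → W.bMinus (ξ i) (ξ j) ≠ 0) (μ ν : Fin M → Λ) :
    W.scalarProduct ξ μ ν = ∑ l : Fin M ↪o Fin L,
      W.subsetWeight ξ μ ν l * W.dwpfC ν (ξ ∘ l) * W.dwpfB μ (ξ ∘ l) := by
  have h := hYB.dotProduct_creations hU hξ (hYB.isCovariant_braAnnihilations hU μ)
    (S := Finset.univ) (z := []) (by simp) ν
  have hone : indicatorState (Finset.univ : Finset (Fin L)) = fun _ => 1 := by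
    funext i; simp [indicatorState]
  have hfin : W.inversionWeight ξ (List.finRange L) = 1 := by
    rw [← Fin.sort_univ]
    exact inversionWeight_of_pairwise (Finset.pairwise_sort _ _)
  rw [hone, Fin.sort_univ, List.append_nil, braAnnihilations, hfin, one_smul,
    ← dotProduct_mulVec, mulVec_mulVec, ← prodB_eq_annihilations, ← prodC_eq_creations,
    ← state1_eq_ket] at h
  rw [scalarProduct, h]
  simp only [Finset.mem_univ, implies_true, and_true, List.append_nil]
  rw [Fin.sum_injective_eq_sum_orderEmb_perm fun f : Fin M → Fin L => W.pairWeight ξ ν f *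
    W.outerWeight ξ ν f (Finset.univ \ Finset.univ.image f) *
      (W.braAnnihilations ξ μ ((Finset.univ \ Finset.univ.image f).sort (· ≤ ·) ++ (List.ofFn f).reverse)
        ⬝ᵥ ket (indicatorState (Finset.univ \ Finset.univ.image f)))]
  refine Finset.sum_congr rfl fun l _ => ?_
  rw [dwpfC_eq_sum (η := ξ ∘ l) hYB hU fun i j hij => hξ _ _ (l.injective.ne hij), Finset.mul_sum,
    Finset.sum_mul]
  refine Finset.sum_congr rfl fun σ _ => ?_
  have himg : Finset.univ.image (l ∘ σ) = Finset.univ.image l := by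
    rw [← Finset.image_image, Finset.image_univ_of_surjective σ.surjective]
  rw [himg]
  set P := Finset.univ \ Finset.univ.image l with hP
  -- The chosen sites all carry 0, so covariance allows them to be sorted for free: the B factor
  -- depends only on the subset, and `σ` survives only in the weight of type C.
  have hperm : (List.ofFn (l ∘ σ)).reverse.Perm ((List.finRange M).map l) := by
    refine (List.reverse_perm _).trans ?_
    rw [List.ofFn_eq_map, ← List.map_map]
    refine List.Perm.map l ?_
    rw [← List.ofFn_eq_map]
    simpa [List.ofFn_eq_map] using Equiv.Perm.ofFn_comp_perm σ (id : Fin M → Fin M)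
  have hnodup : (P.sort ++ (List.ofFn (l ∘ σ)).reverse).Nodup := by
    rw [List.nodup_append, List.nodup_reverse, List.nodup_ofFn]
    refine ⟨Finset.sort_nodup _ _, l.injective.comp σ.injective, ?_⟩
    rintro a ha _ hb rfl
    rw [Finset.mem_sort, hP] at ha
    rw [List.mem_reverse, List.mem_ofFn] at hb
    obtain ⟨i, rfl⟩ := hb
    simp at ha
  have hzero : ∀ i ∈ (List.ofFn (l ∘ σ)).reverse, indicatorState P i = 0 := by
    intro i hi
    rw [List.mem_reverse, List.mem_ofFn] at hi
    obtain ⟨k, rfl⟩ := hi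
    simp [indicatorState, hP]
  rw [(hYB.isCovariant_braAnnihilations hU μ).dotProduct_ket_perm hperm hnodup hzero,
    braAnnihilations_dotProduct_ket μ l hP, pairWeight_comp,
    hU.subsetWeight_eq μ ν l σ (P := P) (by rw [hP, Finset.compl_eq_univ_sdiff]), dwpfB]
  ring

end ScalarProduct

end SixVertexWeights

theorem mainTheorem3 {Λ : Type*} (W : SixVertexWeights Λ) (hU : W.IsUnitary) (hYB : W.YangBaxter)
    (L M : ℕ) (ξ : Fin L → Λ) (hξ : ∀ i j : Fin L, i ≠ j → W.bMinus (ξ i) (ξ j) ≠ 0)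
    (μ ν : Fin M → Λ) :
    W.scalarProduct ξ μ ν =
        ∑ l : Fin M ↪o Fin L,
          W.subsetWeight ξ μ ν l * W.dwpfC ν (fun m => ξ (l m)) * W.dwpfB μ (fun m => ξ (l m)) ∧
      W.scalarProduct ξ μ ν =
        ∑ l : Fin M ↪o Fin L, ∑ σ : Equiv.Perm (Fin M), ∑ τ : Equiv.Perm (Fin M),
          W.subsetWeight ξ μ ν l *
            (∏ i : Fin M, W.cMinus (ν i) (ξ (l (σ i))) * W.cPlus (μ i) (ξ (l (τ i)))) *
            ∏ j : Fin M, ∏ k ∈ Finset.Ioi j,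
              (W.theta ξ (l (σ k)) (l (σ j)) / W.theta ξ (l (τ j)) (l (τ k))) *
                ((W.bMinus (ν k) (ξ (l (σ j))) * W.bMinus (μ k) (ξ (l (τ j))) *
                    W.aMinus (ν j) (ξ (l (σ k))) * W.aMinus (μ j) (ξ (l (τ k)))) /
                  (W.bMinus (ξ (l (σ k))) (ξ (l (σ j))) *
                    W.bMinus (ξ (l (τ k))) (ξ (l (τ j))))) := by
  have h := hYB.scalarProduct_eq_sum hU hξ μ ν
  refine ⟨h, ?_⟩
  rw [h]
  refine Finset.sum_congr rfl fun l _ => ?_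
  have hη : ∀ i j : Fin M, i ≠ j → W.bMinus ((ξ ∘ l) i) ((ξ ∘ l) j) ≠ 0 := fun i j hij =>
    hξ _ _ (l.injective.ne hij)
  rw [SixVertexWeights.dwpfC_eq_sum hYB hU hη, SixVertexWeights.dwpfB_eq_sum hYB hU hη, mul_assoc,
    Finset.sum_mul_sum, Finset.mul_sum]
  refine Finset.sum_congr rfl fun σ _ => ?_
  rw [Finset.mul_sum]
  refine Finset.sum_congr rfl fun τ _ => ?_
  have hθ : ∀ i j, W.siteTheta (ξ ∘ l) i j = W.theta ξ (l i) (l j) := fun i j => by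
    simp [SixVertexWeights.siteTheta, SixVertexWeights.theta]
  rw [mul_assoc, SixVertexWeights.pairWeight, mul_mul_mul_comm, ← Finset.prod_mul_distrib,
    ← Finset.prod_mul_distrib]
  congr 2
  refine Finset.prod_congr rfl fun j _ => ?_
  rw [← Finset.prod_mul_distrib]
  refine Finset.prod_congr rfl fun k _ => ?_
  simp only [hθ, Function.comp_apply, div_eq_mul_inv, mul_inv]
  ring
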